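/- Formulas are $A ::= p \mid \bot \mid \top \mid A\land A \mid A\lor A \mid A\to A \mid \Box A$, with $p$ from a countable set of atoms. Fix one of the eight logics of the classical cube, i.e. $\mathbf E$ extended with any subset of the axioms $M,C,N$. **Hypersequents.** A block $\langle\Sigma\rangle$ consists of a finite non-empty multiset $\Sigma$ of formulas; a sequent is $\Gamma\Rightarrow\Delta$ with $\Gamma$ a finite multiset of formulas and blocks and $\Delta$ a finite multiset of formulas; a hypersequent is a finite multiset $\Gamma_1\Rightarrow\Delta_1\mid\dots\mid\Gamma_n\Rightarrow\Delta_n$ of sequents (its components), and $n$ is its length. The calculus $\mathsf H\mathbf E^*$ has the initial hypersequents $G\mid p,\Gamma\Rightarrow\Delta,p$; $\;G\mid\bot,\Gamma\Rightarrow\Delta$; $\;G\mid\Gamma\Rightarrow\top,\Delta$; the usual two-sided classical rules for $\land,\lor,\to$ applied to one component, in cumulative form (the principal formula is repeated in every premiss); and the rules * $\mathsf L\Box$: from $G\mid\Gamma,\Box A,\langle A\rangle\Rightarrow\Delta$ infer $G\mid\Gamma,\Box A\Rightarrow\Delta$; * $\mathsf R\Box$ (logics without $M$): from $G\mid\Gamma,\langle\Sigma\rangle\Rightarrow\Box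 B,\Delta\mid\Sigma\Rightarrow B$ and $G\mid\Gamma,\langle\Sigma\rangle\Rightarrow\Box B,\Delta\mid B\Rightarrow A$ for every $A\in\Sigma$, infer $G\mid\Gamma,\langle\Sigma\rangle\Rightarrow\Box B,\Delta$; for logics with $M$ it is replaced by the rule with the first premiss only; * for logics with $N$: from $G\mid\Gamma,\langle\top\rangle\Rightarrow\Delta$ infer $G\mid\Gamma\Rightarrow\Delta$; * for logics with $C$: from $G\mid\Gamma,\langle\Sigma\rangle,\langle\Pi\rangle,\langle\Sigma,\Pi\rangle\Rightarrow\Delta$ infer $G\mid\Gamma,\langle\Sigma\rangle,\langle\Pi\rangle\Rightarrow\Delta$. **Labelled sequents.** There are countably many world labels $x,y,\dots$, countably many neighbourhood labels $a,b,\dots$, and a neighbourhood constant $\tau$. A positive term $t$ is a finite non-empty multiset, written $a_1\dots a_s$, of neighbourhood labels and $\tau$; $ts$ is multiset sum; $\overline t$ is a negative term; $\mathsf t$ stands for $t$ or $\overline t$. Labelled formulas are $x:A$, $\;t\Vdash^\forall A$, $\;\overline t\Vdash^\exists A$, $\;x\in\mathsf t$, $\;t\vartriangleright x$. Labelled sequents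 $\Gamma\Rightarrow\Delta$ are pairs of finite multisets of labelled formulas. The calculus $\mathbf{LSE}^*$ has the axioms $x:p,\Gamma\Rightarrow\Delta,x:p$; $\;x:\bot,\Gamma\Rightarrow\Delta$; $\;\Gamma\Rightarrow\Delta,x:\top$; $\;x\in\overline\tau,\Gamma\Rightarrow\Delta$; the usual classical rules for formulas $x:A\circ B$, $\circ\in\{\land,\lor,\to\}$ (principal formula not repeated); and the rules (premisses / conclusion) * $\mathsf L\Box$: $\;a\vartriangleright x,\ a\Vdash^\forall A,\ \Gamma\Rightarrow\Delta,\ \overline a\Vdash^\exists A\;/\;x:\Box A,\Gamma\Rightarrow\Delta$, with $a$ a neighbourhood label not in the conclusion; * $\mathsf R\Box$: $\;t\vartriangleright x,\Gamma\Rightarrow\Delta,x:\Box A,t\Vdash^\forall A$ and $t\vartriangleright x,\overline t\Vdash^\exists A,\Gamma\Rightarrow\Delta,x:\Box A\;/\;t\vartriangleright x,\Gamma\Rightarrow\Delta,x:\Box A$; * $\mathsf L{\Vdash^\forall}$: $\;x\in t,\ x:A,\ t\Vdash^\forall A,\Gamma\Rightarrow\Delta\;/\;x\in t,\ t\Vdash^\forall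 A,\Gamma\Rightarrow\Delta$; * $\mathsf R{\Vdash^\forall}$: $\;y\in t,\Gamma\Rightarrow\Delta,y:A\;/\;\Gamma\Rightarrow\Delta,t\Vdash^\forall A$, with $y$ not in the conclusion; * $\mathsf L{\Vdash^\exists}$: $\;y\in\overline t,\ y:A,\Gamma\Rightarrow\Delta\;/\;\overline t\Vdash^\exists A,\Gamma\Rightarrow\Delta$, with $y$ not in the conclusion; * $\mathsf R{\Vdash^\exists}$: $\;x\in\overline t,\Gamma\Rightarrow\Delta,x:A,\overline t\Vdash^\exists A\;/\;x\in\overline t,\Gamma\Rightarrow\Delta,\overline t\Vdash^\exists A$; * $\mathsf{dec}$: $\;x\in t,\ x\in s,\ x\in ts,\Gamma\Rightarrow\Delta\;/\;x\in ts,\Gamma\Rightarrow\Delta$; * $\overline{\mathsf{dec}}$: $\;x\in\overline t,\ x\in\overline{ts},\Gamma\Rightarrow\Delta$ and $x\in\overline s,\ x\in\overline{ts},\Gamma\Rightarrow\Delta\;/\;x\in\overline{ts},\Gamma\Rightarrow\Delta$; * for logics with $M$, the axiom $t\vartriangleright x,\ y\in\overline t,\Gamma\Rightarrow\Delta$; *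 for logics with $N$: $\;\tau\vartriangleright x,\Gamma\Rightarrow\Delta\;/\;\Gamma\Rightarrow\Delta$, with $x$ occurring in the conclusion; * for logics with $C$: $\;ts\vartriangleright x,\ t\vartriangleright x,\ s\vartriangleright x,\Gamma\Rightarrow\Delta\;/\;t\vartriangleright x,\ s\vartriangleright x,\Gamma\Rightarrow\Delta$. **Translation.** Let $H$ be a hypersequent of length $n$. Enumerate its components; let the $k$-th one be $\Gamma_k,\langle\Sigma^k_1\rangle,\dots,\langle\Sigma^k_{l_k}\rangle\Rightarrow\Delta_k$ with $\Sigma^k_i=\{A^k_{i1},\dots,A^k_{is_{ik}}\}$. Choose pairwise distinct world labels $x_1,\dots,x_n$ and, for every formula occurrence $A^k_{ij}$ in a block, a neighbourhood label or constant $a^k_{ij}$, in such a way that equal labels are attached to equal formulas only, and $\tau$ to $\top$ only (so the block $\langle\top\rangle$ may be represented by $\tau$). Put $a^k_i=a^k_{i1}\dots a^k_{is_{ik}}$. For each component $m$ choose either no origin or an origin $b_m$, where $b_m$ is a term of the kind that $\mathsf R\Box$ can introduce with the $m$-th component: for some $k<m$ and $i$, either $b_m=a^k_i$ and every formula of $\Sigma^k_i$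 is in $\Gamma_m$, or the logic does not contain $M$, $b_m=\overline{a^k_i}$ and some formula of $\Sigma^k_i$ is in $\Delta_m$. The translation of $H$ for these parameters is the labelled sequent whose antecedent consists, for all $k$, of $x_k\in b_k$ (if $b_k$ is chosen), $a^k_i\vartriangleright x_k$ (all $i$), $a^k_{ij}\Vdash^\forall A^k_{ij}$ (all $i,j$) and $x_k:A$ ($A\in\Gamma_k$), and whose succedent consists, for all $k$, of $x_k:A$ ($A\in\Delta_k$) and $\overline{a^k_{ij}}\Vdash^\exists A^k_{ij}$ (all $i,j$). **Theorem.** For each of the eight logics of the classical cube, every hypersequent $H$ of length $n$, and every choice of the parameters of the translation as above, the following are equivalent: 1. $H$ is provable in $\mathsf H\mathbf E^*$; 2. the translation of $H$ is provable in $\mathbf{LSE}^*$. -/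

import Mathlib

/-! ## Formulas and the classical cube -/

/-- Modal formulas over countably many atoms. -/
inductive Fm : Type
  | atom (p : ℕ)
  | bot
  | top
  | and (A B : Fm)
  | or (A B : Fm)
  | imp (A B : Fm)
  | box (A : Fm)

/-- A system of the classical cube: the choice of the axioms M, C, N that are added to E. -/
structure CubeSystem where
  hasM : Bool
  hasC : Bool
  hasN : Bool

/-! ## Finite non-empty multisets -/

/-- Finite non-empty multisets (used for blocks and for neighbourhood terms). -/
def NEMultiset (α : Type) : Type := {s : Multiset α // s ≠ 0}

namespace NEMultiset

def single {α : Type} (a : α) : NEMultiset α := ⟨{a}, Multiset.singleton_ne_zero a⟩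

def add {α : Type} (s t : NEMultiset α) : NEMultiset α :=
  ⟨s.1 + t.1, fun h => s.2 (add_eq_zero.mp h).1⟩

def map {α β : Type} (f : α → β) (s : NEMultiset α) : NEMultiset β :=
  ⟨s.1.map f, fun h => s.2 (Multiset.map_eq_zero.mp h)⟩

end NEMultiset

/-! ## The hypersequent calculi -/

/-- A block `⟨S⟩`. -/
abbrev Block : Type := NEMultiset Fm

/-- A sequent `Γ ⇒ Δ`, where `Γ` consists of formulas (`ant`) and of blocks (`blocks`). -/
structure Sequent where
  ant : Multiset Fm
  blocks : Multiset Block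
  suc : Multiset Fm

/-- A hypersequent is a finite multiset of sequents, its components. -/
abbrev Hypersequent : Type := Multiset Sequent

/-- Provability in the hypersequent calculus of the system `L` of the classical cube.
The rules are cumulative.  The monotonic systems have the right box rule `boxRM` with the single
positive premiss, the others have the right box rule `boxR`. -/
inductive HProvable (L : CubeSystem) : Hypersequent → Prop
  | ax (G : Hypersequent) (Γ : Multiset Fm) (Θ : Multiset Block) (Δ : Multiset Fm) (p : ℕ) :
      HProvable L (⟨Fm.atom p ::ₘ Γ, Θ, Fm.atom p ::ₘ Δ⟩ ::ₘ G)
  | botL (G : Hypersequent) (Γ : Multiset Fm) (Θ : Multiset Block) (Δ : Multiset Fm) :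
      HProvable L (⟨Fm.bot ::ₘ Γ, Θ, Δ⟩ ::ₘ G)
  | topR (G : Hypersequent) (Γ : Multiset Fm) (Θ : Multiset Block) (Δ : Multiset Fm) :
      HProvable L (⟨Γ, Θ, Fm.top ::ₘ Δ⟩ ::ₘ G)
  | impL (G : Hypersequent) (Γ : Multiset Fm) (Θ : Multiset Block) (Δ : Multiset Fm) (A B : Fm) :
      HProvable L (⟨A.imp B ::ₘ Γ, Θ, A ::ₘ Δ⟩ ::ₘ G) →
      HProvable L (⟨B ::ₘ A.imp B ::ₘ Γ, Θ, Δ⟩ ::ₘ G) →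
      HProvable L (⟨A.imp B ::ₘ Γ, Θ, Δ⟩ ::ₘ G)
  | impR (G : Hypersequent) (Γ : Multiset Fm) (Θ : Multiset Block) (Δ : Multiset Fm) (A B : Fm) :
      HProvable L (⟨A ::ₘ Γ, Θ, B ::ₘ A.imp B ::ₘ Δ⟩ ::ₘ G) →
      HProvable L (⟨Γ, Θ, A.imp B ::ₘ Δ⟩ ::ₘ G)
  | andL (G : Hypersequent) (Γ : Multiset Fm) (Θ : Multiset Block) (Δ : Multiset Fm) (A B : Fm) :
      HProvable L (⟨A ::ₘ B ::ₘ A.and B ::ₘ Γ, Θ, Δ⟩ ::ₘ G) →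
      HProvable L (⟨A.and B ::ₘ Γ, Θ, Δ⟩ ::ₘ G)
  | andR (G : Hypersequent) (Γ : Multiset Fm) (Θ : Multiset Block) (Δ : Multiset Fm) (A B : Fm) :
      HProvable L (⟨Γ, Θ, A ::ₘ A.and B ::ₘ Δ⟩ ::ₘ G) →
      HProvable L (⟨Γ, Θ, B ::ₘ A.and B ::ₘ Δ⟩ ::ₘ G) →
      HProvable L (⟨Γ, Θ, A.and B ::ₘ Δ⟩ ::ₘ G)
  | orL (G : Hypersequent) (Γ : Multiset Fm) (Θ : Multiset Block) (Δ : Multiset Fm) (A B : Fm) :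
      HProvable L (⟨A ::ₘ A.or B ::ₘ Γ, Θ, Δ⟩ ::ₘ G) →
      HProvable L (⟨B ::ₘ A.or B ::ₘ Γ, Θ, Δ⟩ ::ₘ G) →
      HProvable L (⟨A.or B ::ₘ Γ, Θ, Δ⟩ ::ₘ G)
  | orR (G : Hypersequent) (Γ : Multiset Fm) (Θ : Multiset Block) (Δ : Multiset Fm) (A B : Fm) :
      HProvable L (⟨Γ, Θ, A ::ₘ B ::ₘ A.or B ::ₘ Δ⟩ ::ₘ G) →
      HProvable L (⟨Γ, Θ, A.or B ::ₘ Δ⟩ ::ₘ G)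
  | boxL (G : Hypersequent) (Γ : Multiset Fm) (Θ : Multiset Block) (Δ : Multiset Fm) (A : Fm) :
      HProvable L (⟨A.box ::ₘ Γ, NEMultiset.single A ::ₘ Θ, Δ⟩ ::ₘ G) →
      HProvable L (⟨A.box ::ₘ Γ, Θ, Δ⟩ ::ₘ G)
  | boxR (hM : L.hasM = false) (G : Hypersequent) (Γ : Multiset Fm) (Θ : Multiset Block)
      (Δ : Multiset Fm) (S : Block) (B : Fm) :
      HProvable L (⟨S.1, 0, {B}⟩ ::ₘ ⟨Γ, S ::ₘ Θ, B.box ::ₘ Δ⟩ ::ₘ G) →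
      (∀ A ∈ S.1, HProvable L (⟨{B}, 0, {A}⟩ ::ₘ ⟨Γ, S ::ₘ Θ, B.box ::ₘ Δ⟩ ::ₘ G)) →
      HProvable L (⟨Γ, S ::ₘ Θ, B.box ::ₘ Δ⟩ ::ₘ G)
  | boxRM (hM : L.hasM = true) (G : Hypersequent) (Γ : Multiset Fm) (Θ : Multiset Block)
      (Δ : Multiset Fm) (S : Block) (B : Fm) :
      HProvable L (⟨S.1, 0, {B}⟩ ::ₘ ⟨Γ, S ::ₘ Θ, B.box ::ₘ Δ⟩ ::ₘ G) →
      HProvable L (⟨Γ, S ::ₘ Θ, B.box ::ₘ Δ⟩ ::ₘ G)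
  | ruleN (hN : L.hasN = true) (G : Hypersequent) (Γ : Multiset Fm) (Θ : Multiset Block)
      (Δ : Multiset Fm) :
      HProvable L (⟨Γ, NEMultiset.single Fm.top ::ₘ Θ, Δ⟩ ::ₘ G) →
      HProvable L (⟨Γ, Θ, Δ⟩ ::ₘ G)
  | ruleC (hC : L.hasC = true) (G : Hypersequent) (Γ : Multiset Fm) (Θ : Multiset Block)
      (Δ : Multiset Fm) (S P : Block) :
      HProvable L (⟨Γ, S.add P ::ₘ S ::ₘ P ::ₘ Θ, Δ⟩ ::ₘ G) →
      HProvable L (⟨Γ, S ::ₘ P ::ₘ Θ, Δ⟩ ::ₘ G)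

/-! ## The labelled calculi -/

/-- World labels. -/
abbrev WLabel : Type := ℕ

/-- Constituents of neighbourhood terms: neighbourhood labels and the constant `τ`. -/
inductive NLabel : Type
  | var (a : ℕ)
  | tau

/-- Positive neighbourhood terms. -/
abbrev Term : Type := NEMultiset NLabel

/-- Neighbourhood terms: `pos t` is `t`, and `neg t` is the overlined term. -/
inductive STerm : Type
  | pos (t : Term)
  | neg (t : Term)

/-- Labelled formulas. -/
inductive LFm : Type
  /-- `x : A` -/
  | holds (x : WLabel) (A : Fm)
  /-- `t ⊩∀ A` -/
  | all (t : Term) (A : Fm)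
  /-- `t̄ ⊩∃ A` -/
  | ex (t : Term) (A : Fm)
  /-- `x ∈ u`, for a positive or a negative term `u` -/
  | mem (x : WLabel) (u : STerm)
  /-- `t ▷ x` -/
  | nbhd (t : Term) (x : WLabel)

/-- The world label `x` occurs in the labelled formula. -/
def LFm.WorldOccurs (x : WLabel) : LFm → Prop
  | holds y _ => y = x
  | all _ _ => False
  | ex _ _ => False
  | mem y _ => y = x
  | nbhd _ y => y = x

/-- The neighbourhood label `a` occurs in the labelled formula. -/
def LFm.NbhdOccurs (a : ℕ) : LFm → Prop
  | holds _ _ => False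
  | all t _ => NLabel.var a ∈ t.1
  | ex t _ => NLabel.var a ∈ t.1
  | mem _ (STerm.pos t) => NLabel.var a ∈ t.1
  | mem _ (STerm.neg t) => NLabel.var a ∈ t.1
  | nbhd t _ => NLabel.var a ∈ t.1

/-- The world label `x` occurs in the multiset of labelled formulas. -/
def WorldIn (x : WLabel) (Γ : Multiset LFm) : Prop := ∃ φ ∈ Γ, φ.WorldOccurs x

/-- The neighbourhood label `a` occurs in the multiset of labelled formulas. -/
def NbhdIn (a : ℕ) (Γ : Multiset LFm) : Prop := ∃ φ ∈ Γ, φ.NbhdOccurs a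

/-- Labelled sequents. -/
structure LSequent where
  ant : Multiset LFm
  suc : Multiset LFm

open LFm in
/-- Provability in the labelled calculus of the system `L` of the classical cube. -/
inductive LProvable (L : CubeSystem) : LSequent → Prop
  | ax (Γ Δ : Multiset LFm) (x : WLabel) (p : ℕ) :
      LProvable L ⟨holds x (Fm.atom p) ::ₘ Γ, holds x (Fm.atom p) ::ₘ Δ⟩
  | botL (Γ Δ : Multiset LFm) (x : WLabel) : LProvable L ⟨holds x Fm.bot ::ₘ Γ, Δ⟩
  | topR (Γ Δ : Multiset LFm) (x : WLabel) : LProvable L ⟨Γ, holds x Fm.top ::ₘ Δ⟩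
  | impL (Γ Δ : Multiset LFm) (x : WLabel) (A B : Fm) :
      LProvable L ⟨Γ, holds x A ::ₘ Δ⟩ →
      LProvable L ⟨holds x B ::ₘ Γ, Δ⟩ →
      LProvable L ⟨holds x (A.imp B) ::ₘ Γ, Δ⟩
  | impR (Γ Δ : Multiset LFm) (x : WLabel) (A B : Fm) :
      LProvable L ⟨holds x A ::ₘ Γ, holds x B ::ₘ Δ⟩ →
      LProvable L ⟨Γ, holds x (A.imp B) ::ₘ Δ⟩
  | andL (Γ Δ : Multiset LFm) (x : WLabel) (A B : Fm) :
      LProvable L ⟨holds x A ::ₘ holds x B ::ₘ Γ, Δ⟩ →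
      LProvable L ⟨holds x (A.and B) ::ₘ Γ, Δ⟩
  | andR (Γ Δ : Multiset LFm) (x : WLabel) (A B : Fm) :
      LProvable L ⟨Γ, holds x A ::ₘ Δ⟩ →
      LProvable L ⟨Γ, holds x B ::ₘ Δ⟩ →
      LProvable L ⟨Γ, holds x (A.and B) ::ₘ Δ⟩
  | orL (Γ Δ : Multiset LFm) (x : WLabel) (A B : Fm) :
      LProvable L ⟨holds x A ::ₘ Γ, Δ⟩ →
      LProvable L ⟨holds x B ::ₘ Γ, Δ⟩ →
      LProvable L ⟨holds x (A.or B) ::ₘ Γ, Δ⟩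
  | orR (Γ Δ : Multiset LFm) (x : WLabel) (A B : Fm) :
      LProvable L ⟨Γ, holds x A ::ₘ holds x B ::ₘ Δ⟩ →
      LProvable L ⟨Γ, holds x (A.or B) ::ₘ Δ⟩
  | boxL (Γ Δ : Multiset LFm) (x : WLabel) (A : Fm) (a : ℕ) :
      ¬ NbhdIn a Γ → ¬ NbhdIn a Δ →
      LProvable L
        ⟨nbhd (NEMultiset.single (NLabel.var a)) x ::ₘ
          all (NEMultiset.single (NLabel.var a)) A ::ₘ Γ,
          ex (NEMultiset.single (NLabel.var a)) A ::ₘ Δ⟩ →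
      LProvable L ⟨holds x A.box ::ₘ Γ, Δ⟩
  | boxR (Γ Δ : Multiset LFm) (x : WLabel) (A : Fm) (t : Term) :
      LProvable L ⟨nbhd t x ::ₘ Γ, all t A ::ₘ holds x A.box ::ₘ Δ⟩ →
      LProvable L ⟨nbhd t x ::ₘ ex t A ::ₘ Γ, holds x A.box ::ₘ Δ⟩ →
      LProvable L ⟨nbhd t x ::ₘ Γ, holds x A.box ::ₘ Δ⟩
  | ruleM (hM : L.hasM = true) (Γ Δ : Multiset LFm) (x y : WLabel) (t : Term) :
      LProvable L ⟨nbhd t x ::ₘ mem y (STerm.neg t) ::ₘ Γ, Δ⟩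
  | ruleN (hN : L.hasN = true) (Γ Δ : Multiset LFm) (x : WLabel) :
      (WorldIn x Γ ∨ WorldIn x Δ) →
      LProvable L ⟨nbhd (NEMultiset.single NLabel.tau) x ::ₘ Γ, Δ⟩ →
      LProvable L ⟨Γ, Δ⟩
  | ruleC (hC : L.hasC = true) (Γ Δ : Multiset LFm) (x : WLabel) (t s : Term) :
      LProvable L ⟨nbhd (t.add s) x ::ₘ nbhd t x ::ₘ nbhd s x ::ₘ Γ, Δ⟩ →
      LProvable L ⟨nbhd t x ::ₘ nbhd s x ::ₘ Γ, Δ⟩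
  | allL (Γ Δ : Multiset LFm) (x : WLabel) (A : Fm) (t : Term) :
      LProvable L ⟨mem x (STerm.pos t) ::ₘ holds x A ::ₘ all t A ::ₘ Γ, Δ⟩ →
      LProvable L ⟨mem x (STerm.pos t) ::ₘ all t A ::ₘ Γ, Δ⟩
  | allR (Γ Δ : Multiset LFm) (y : WLabel) (A : Fm) (t : Term) :
      ¬ WorldIn y Γ → ¬ WorldIn y Δ →
      LProvable L ⟨mem y (STerm.pos t) ::ₘ Γ, holds y A ::ₘ Δ⟩ →
      LProvable L ⟨Γ, all t A ::ₘ Δ⟩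
  | exL (Γ Δ : Multiset LFm) (y : WLabel) (A : Fm) (t : Term) :
      ¬ WorldIn y Γ → ¬ WorldIn y Δ →
      LProvable L ⟨mem y (STerm.neg t) ::ₘ holds y A ::ₘ Γ, Δ⟩ →
      LProvable L ⟨ex t A ::ₘ Γ, Δ⟩
  | exR (Γ Δ : Multiset LFm) (x : WLabel) (A : Fm) (t : Term) :
      LProvable L ⟨mem x (STerm.neg t) ::ₘ Γ, holds x A ::ₘ ex t A ::ₘ Δ⟩ →
      LProvable L ⟨mem x (STerm.neg t) ::ₘ Γ, ex t A ::ₘ Δ⟩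
  | decPos (Γ Δ : Multiset LFm) (x : WLabel) (t s : Term) :
      LProvable L ⟨mem x (STerm.pos t) ::ₘ mem x (STerm.pos s) ::ₘ
        mem x (STerm.pos (t.add s)) ::ₘ Γ, Δ⟩ →
      LProvable L ⟨mem x (STerm.pos (t.add s)) ::ₘ Γ, Δ⟩
  | decNeg (Γ Δ : Multiset LFm) (x : WLabel) (t s : Term) :
      LProvable L ⟨mem x (STerm.neg t) ::ₘ mem x (STerm.neg (t.add s)) ::ₘ Γ, Δ⟩ →
      LProvable L ⟨mem x (STerm.neg s) ::ₘ mem x (STerm.neg (t.add s)) ::ₘ Γ, Δ⟩ →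
      LProvable L ⟨mem x (STerm.neg (t.add s)) ::ₘ Γ, Δ⟩
  | tauEmpty (Γ Δ : Multiset LFm) (x : WLabel) :
      LProvable L ⟨mem x (STerm.neg (NEMultiset.single NLabel.tau)) ::ₘ Γ, Δ⟩

/-! ## The translation -/

/-- A block in which every formula occurrence `A_j` comes with a label `a_j`. -/
abbrev LBlock : Type := NEMultiset (NLabel × Fm)

/-- The block `⟨A_1, …, A_s⟩`. -/
def LBlock.toBlock (S : LBlock) : Block := NEMultiset.map Prod.snd S

/-- The term `a_1 … a_s` that represents the block. -/
def LBlock.term (S : LBlock) : Term := NEMultiset.map Prod.fst S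

/-- A component whose blocks are labelled. -/
structure LComponent where
  ant : Multiset Fm
  blocks : Multiset LBlock
  suc : Multiset Fm

def LComponent.toSequent (S : LComponent) : Sequent :=
  ⟨S.ant, S.blocks.map LBlock.toBlock, S.suc⟩

/-- The parameters of the translation of a hypersequent of length `n`: an enumeration of its
components, with labelled blocks, a world label `x_k` for every component, and for every component
the neighbourhood term `b_k`, if there is one, to which `x_k` is declared to belong. -/
structure Labelling (n : ℕ) where
  comp : Fin n → LComponent
  world : Fin n → WLabel
  origin : Fin n → Option STerm

namespace Labelling

/-- The labelled components are an enumeration of the components of `H`. -/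
def Enumerates {n : ℕ} (D : Labelling n) (H : Hypersequent) : Prop :=
  Finset.univ.val.map (fun k => (D.comp k).toSequent) = H

/-- The formula occurrence `A` in some block of the `k`-th component has the label `a`. -/
def Attaches {n : ℕ} (D : Labelling n) (k : Fin n) (a : NLabel) (A : Fm) : Prop :=
  ∃ S ∈ (D.comp k).blocks, (a, A) ∈ S.1

/-- Equal labels are attached to equal formulas only, and `τ` is attached to `⊤` only. -/
def Consistent {n : ℕ} (D : Labelling n) : Prop :=
  (∀ k k' a A A', D.Attaches k a A → D.Attaches k' a A' → A = A') ∧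
    ∀ k A, D.Attaches k NLabel.tau A → A = Fm.top

/-- The term `b_m` is one that the right box rule of the system `L` can introduce with the `m`-th
component: it is the term `t` of a block of an earlier component, all of whose formulas are in the
antecedent of the `m`-th one, or, if `L` is not monotonic, the overlining of such a term `t` where
some formula of the block is in the succedent of the `m`-th component. -/
def OriginsAdmissible {n : ℕ} (D : Labelling n) (L : CubeSystem) : Prop :=
  ∀ m u, D.origin m = some u →
    ∃ k < m, ∃ S ∈ (D.comp k).blocks,
      (u = STerm.pos S.term ∧ ∀ A ∈ S.toBlock.1, A ∈ (D.comp m).ant) ∨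
      (u = STerm.neg S.term ∧ L.hasM = false ∧ ∃ A ∈ S.toBlock.1, A ∈ (D.comp m).suc)

/-- The antecedent of the translation of the `k`-th component:
`x_k ∈ b_k`, `a_i ▷ x_k`, `a_ij ⊩∀ A_ij`, `x_k : Γ`. -/
def compAnt {n : ℕ} (D : Labelling n) (k : Fin n) : Multiset LFm :=
  (match D.origin k with
    | none => 0
    | some u => {LFm.mem (D.world k) u}) +
  (D.comp k).blocks.map (fun S => LFm.nbhd S.term (D.world k)) +
  (D.comp k).blocks.bind (fun S => S.1.map (fun q => LFm.all (NEMultiset.single q.1) q.2)) +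
  (D.comp k).ant.map (LFm.holds (D.world k))

/-- The succedent of the translation of the `k`-th component: `x_k : Δ`, `ā_ij ⊩∃ A_ij`. -/
def compSuc {n : ℕ} (D : Labelling n) (k : Fin n) : Multiset LFm :=
  (D.comp k).suc.map (LFm.holds (D.world k)) +
  (D.comp k).blocks.bind (fun S => S.1.map (fun q => LFm.ex (NEMultiset.single q.1) q.2))

/-- The translation: the concatenation of the translations of all components. -/
def translation {n : ℕ} (D : Labelling n) : LSequent :=
  ⟨∑ k, D.compAnt k, ∑ k, D.compSuc k⟩

end Labelling

/-! Both provability statements are equivalent to a semantic one: some component of the hypersequent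
is valid in all neighbourhood models of the logic. The separators, and the origins recorded in the
translation, therefore carry no deductive content.

From validity to proofs, the bridge is `SProvable`, a calculus for single sequents. It is complete
(`SProvable.of_valid`): decompose propositionally, turn boxes on the left into blocks, and build a
countermodel by adding a root to a universal model when no boxed succedent formula follows from the
blocks. Its derivations can be replayed inside one component of any hypersequent
(`SProvable.hProvable`) and at one world label of any labelled sequent containing the translated
component (`SProvable.lProvable`).

From proofs to validity, the hypersequent rules preserve the existence of a valid component
(`HProvable.exists_valid`). For the labelled calculus, soundness (`LProvable.sound`) is applied in a
model that falsifies all invalid sequents at once. If every component were invalid, sending each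
world label to a falsifying world, and each neighbourhood label to the truth set of its formula,
would refute the translation. -/

open Multiset in
theorem Multiset.exists_cons_of_cons_le {α : Type*} {a : α} {s t : Multiset α} (h : a ::ₘ s ≤ t) :
    ∃ r, t = a ::ₘ r ∧ s ≤ r := by
  obtain ⟨r, rfl⟩ := exists_cons_of_mem (subset_of_le h (mem_cons_self a s))
  exact ⟨r, rfl, (cons_le_cons_iff a).1 h⟩

theorem Multiset.exists_of_map_eq_cons {α β : Type*} {f : α → β} {s : Multiset α} {b : β}
    {t : Multiset β} (h : s.map f = b ::ₘ t) : ∃ a s', s = a ::ₘ s' ∧ f a = b ∧ s'.map f = t := by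
  obtain ⟨a, ha, rfl⟩ := Multiset.mem_map.1 (h ▸ Multiset.mem_cons_self b t)
  obtain ⟨s', rfl⟩ := Multiset.exists_cons_of_mem ha
  exact ⟨a, s', rfl, rfl, by simpa using h⟩

/-! ## Neighbourhood models -/

/-- Neighbourhood models of the logic `L`. -/
structure NModel (L : CubeSystem) where
  W : Type
  N : W → Set (Set W)
  V : W → ℕ → Prop
  mono : L.hasM = true → ∀ w X Y, X ∈ N w → X ⊆ Y → Y ∈ N w
  inter : L.hasC = true → ∀ w X Y, X ∈ N w → Y ∈ N w → X ∩ Y ∈ N w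
  univ : L.hasN = true → ∀ w, Set.univ ∈ N w

namespace NModel

variable {L : CubeSystem}

/-- The truth set of a formula. -/
def truth (M : NModel L) : Fm → Set M.W
  | Fm.atom p => {w | M.V w p}
  | Fm.bot => ∅
  | Fm.top => Set.univ
  | Fm.and A B => M.truth A ∩ M.truth B
  | Fm.or A B => M.truth A ∪ M.truth B
  | Fm.imp A B => {w | w ∈ M.truth A → w ∈ M.truth B}
  | Fm.box A => {w | M.truth A ∈ M.N w}

/-- The set of worlds at which all formulas of `S` are true. -/
def truthAll (M : NModel L) (S : Multiset Fm) : Set M.W := {w | ∀ A ∈ S, w ∈ M.truth A}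

/-- The world `w` falsifies the sequent `c`. -/
def Falsifies (M : NModel L) (w : M.W) (c : Sequent) : Prop :=
  (∀ A ∈ c.ant, w ∈ M.truth A) ∧ (∀ S ∈ c.blocks, M.truthAll S.1 ∈ M.N w) ∧
    ∀ A ∈ c.suc, w ∉ M.truth A

/-- The disjoint union of a family of models. -/
def disjointUnion {I : Type} (F : I → NModel L) : NModel L where
  W := Σ i, (F i).W
  N w := {X | {v | (⟨w.1, v⟩ : Σ i, (F i).W) ∈ X} ∈ (F w.1).N w.2}
  V w p := (F w.1).V w.2 p
  mono h w _ _ hX hXY := (F w.1).mono h w.2 _ _ hX fun _ hv => hXY hv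
  inter h w _ _ hX hY := (F w.1).inter h w.2 _ _ hX hY
  univ h w := (F w.1).univ h w.2

/-- A set is a neighbourhood of a point exactly when its trace on the summand of that point is one,
so the other summands do not influence truth there. -/
theorem mem_truth_disjointUnion {I : Type} (F : I → NModel L) (A : Fm) :
    ∀ (i : I) (w : (F i).W), (⟨i, w⟩ : Σ i, (F i).W) ∈ (disjointUnion F).truth A ↔
      w ∈ (F i).truth A := by
  induction A with
  | atom p => intro i w; rfl
  | bot => intro i w; rfl
  | top => intro i w; exact Iff.rfl
  | and A B hA hB => intro i w; exact and_congr (hA i w) (hB i w)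
  | or A B hA hB => intro i w; exact or_congr (hA i w) (hB i w)
  | imp A B hA hB => intro i w; exact imp_congr (hA i w) (hB i w)
  | box A hA =>
    intro i w
    have : {v | (⟨i, v⟩ : Σ i, (F i).W) ∈ (disjointUnion F).truth A} = (F i).truth A :=
      Set.ext fun v => hA i v
    change {v | (⟨i, v⟩ : Σ i, (F i).W) ∈ (disjointUnion F).truth A} ∈ (F i).N w ↔ _
    rw [this]; rfl

theorem Falsifies.disjointUnion {I : Type} {F : I → NModel L} {i : I} {w : (F i).W} {c : Sequent}
    (h : (F i).Falsifies w c) : (disjointUnion F).Falsifies ⟨i, w⟩ c := by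
  refine ⟨fun A hA => (mem_truth_disjointUnion F A i w).2 (h.1 A hA), fun S hS => ?_,
    fun A hA hw => h.2.2 A hA ((mem_truth_disjointUnion F A i w).1 hw)⟩
  have : {v | (⟨i, v⟩ : Σ i, (F i).W) ∈ (NModel.disjointUnion F).truthAll S.1} =
      (F i).truthAll S.1 :=
    Set.ext fun v => forall₂_congr fun A _ => mem_truth_disjointUnion F A i v
  change {v | (⟨i, v⟩ : Σ i, (F i).W) ∈ (NModel.disjointUnion F).truthAll S.1} ∈ (F i).N w
  rw [this]; exact h.2.1 S hS

/-- The extension of a model with a root whose neighbourhoods are those sets whose trace on the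
model is in `𝒩`. -/
def addRoot (M : NModel L) (𝒩 : Set (Set M.W)) (P : ℕ → Prop)
    (hM : L.hasM = true → ∀ X Y, X ∈ 𝒩 → X ⊆ Y → Y ∈ 𝒩)
    (hC : L.hasC = true → ∀ X Y, X ∈ 𝒩 → Y ∈ 𝒩 → X ∩ Y ∈ 𝒩)
    (hN : L.hasN = true → Set.univ ∈ 𝒩) : NModel L where
  W := Option M.W
  N w := {X | some ⁻¹' X ∈ w.elim 𝒩 M.N}
  V w p := w.elim (P p) (M.V · p)
  mono h w _ _ hX hXY := by
    cases w
    · exact hM h _ _ hX fun _ hv => hXY hv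
    · exact M.mono h _ _ _ hX fun _ hv => hXY hv
  inter h w _ _ hX hY := by
    cases w
    · exact hC h _ _ hX hY
    · exact M.inter h _ _ _ hX hY
  univ h w := by
    cases w
    · exact hN h
    · exact M.univ h _

section AddRoot

variable (M : NModel L) (𝒩 : Set (Set M.W)) (P : ℕ → Prop)
    (hM : L.hasM = true → ∀ X Y, X ∈ 𝒩 → X ⊆ Y → Y ∈ 𝒩)
    (hC : L.hasC = true → ∀ X Y, X ∈ 𝒩 → Y ∈ 𝒩 → X ∩ Y ∈ 𝒩)
    (hN : L.hasN = true → Set.univ ∈ 𝒩)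

/-- Neighbourhoods are tested on traces only. Hence old worlds do not notice the root, and whether
the root itself satisfies a formula has no effect on the boxes evaluated anywhere. -/
theorem preimage_truth_addRoot (A : Fm) :
    some ⁻¹' (M.addRoot 𝒩 P hM hC hN).truth A = M.truth A := by
  induction A with
  | atom p => rfl
  | bot => rfl
  | top => rfl
  | and A B hA hB => exact congrArg₂ (· ∩ ·) hA hB
  | or A B hA hB => exact congrArg₂ (· ∪ ·) hA hB
  | imp A B hA hB =>
    ext w
    exact imp_congr (Set.ext_iff.1 hA w) (Set.ext_iff.1 hB w)
  | box A hA =>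
    ext w
    change some ⁻¹' (M.addRoot 𝒩 P hM hC hN).truth A ∈ M.N w ↔ _
    rw [hA]; rfl

theorem preimage_truthAll_addRoot (S : Multiset Fm) :
    some ⁻¹' (M.addRoot 𝒩 P hM hC hN).truthAll S = M.truthAll S := by
  ext w
  exact forall₂_congr fun A _ => Set.ext_iff.1 (preimage_truth_addRoot M 𝒩 P hM hC hN A) w

end AddRoot

end NModel

/-- Validity of a sequent in the logic `L`. -/
def Sequent.Valid (L : CubeSystem) (c : Sequent) : Prop :=
  ∀ (M : NModel L) (w : M.W), ¬ M.Falsifies w c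

/-- There is a single model in which all sequents that are not valid are falsified. -/
theorem NModel.exists_universal (L : CubeSystem) :
    ∃ U : NModel L, Nonempty U.W ∧ ∀ c : Sequent, ¬ c.Valid L → ∃ w, U.Falsifies w c := by
  have h : ∀ c : {c : Sequent // ¬ c.Valid L}, ∃ M : NModel L, ∃ w, M.Falsifies w c.1 := by
    rintro ⟨c, hc⟩
    simpa [Sequent.Valid] using hc
  choose F w hw using h
  have hU : ∀ c : Sequent, ¬ c.Valid L → ∃ w, (disjointUnion F).Falsifies w c :=
    fun c hc => ⟨_, (hw ⟨c, hc⟩).disjointUnion⟩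
  refine ⟨disjointUnion F, ?_, hU⟩
  -- A one-point model shows that the empty sequent is invalid, so the union is inhabited; a default
  -- world is needed later for labels that name no component.
  let T : NModel L :=
    { W := Unit, N := fun _ => Set.univ, V := fun _ _ => True
      mono := fun _ _ _ _ _ _ => trivial
      inter := fun _ _ _ _ _ _ => trivial
      univ := fun _ _ => trivial }
  obtain ⟨v, -⟩ := hU ⟨0, 0, 0⟩ fun h => h T () (by simp [Falsifies])
  exact ⟨v⟩

/-- The multiset of all formula occurrences in a multiset of blocks. -/
def blockUnion (Θ : Multiset Block) : Multiset Fm := (Θ.map fun S : Block => S.1).sum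

@[simp] theorem blockUnion_zero : blockUnion 0 = 0 := rfl

@[simp] theorem blockUnion_cons (S : Block) (Θ : Multiset Block) :
    blockUnion (S ::ₘ Θ) = S.1 + blockUnion Θ := by simp [blockUnion]

@[simp] theorem blockUnion_singleton (S : Block) : blockUnion {S} = S.1 := by simp [blockUnion]

@[simp] theorem blockUnion_add (Θ Θ' : Multiset Block) :
    blockUnion (Θ + Θ') = blockUnion Θ + blockUnion Θ' := by simp [blockUnion]

@[simp] theorem NEMultiset.single_val {α : Type} (a : α) : (NEMultiset.single a).1 = {a} := rfl

@[simp] theorem NEMultiset.add_val {α : Type} (s t : NEMultiset α) : (s.add t).1 = s.1 + t.1 := rfl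

/-! ## A contraction-free calculus for single sequents -/

open Classical in
/-- Provability in a calculus for single sequents, without repetition of principal formulas. -/
inductive SProvable (L : CubeSystem) : Sequent → Prop
  | ax (Γ : Multiset Fm) (Θ : Multiset Block) (Δ : Multiset Fm) (p : ℕ) :
      SProvable L ⟨Fm.atom p ::ₘ Γ, Θ, Fm.atom p ::ₘ Δ⟩
  | botL (Γ : Multiset Fm) (Θ : Multiset Block) (Δ : Multiset Fm) :
      SProvable L ⟨Fm.bot ::ₘ Γ, Θ, Δ⟩
  | topR (Γ : Multiset Fm) (Θ : Multiset Block) (Δ : Multiset Fm) :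
      SProvable L ⟨Γ, Θ, Fm.top ::ₘ Δ⟩
  | impL (Γ : Multiset Fm) (Θ : Multiset Block) (Δ : Multiset Fm) (A B : Fm) :
      SProvable L ⟨Γ, Θ, A ::ₘ Δ⟩ → SProvable L ⟨B ::ₘ Γ, Θ, Δ⟩ →
      SProvable L ⟨A.imp B ::ₘ Γ, Θ, Δ⟩
  | impR (Γ : Multiset Fm) (Θ : Multiset Block) (Δ : Multiset Fm) (A B : Fm) :
      SProvable L ⟨A ::ₘ Γ, Θ, B ::ₘ Δ⟩ → SProvable L ⟨Γ, Θ, A.imp B ::ₘ Δ⟩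
  | andL (Γ : Multiset Fm) (Θ : Multiset Block) (Δ : Multiset Fm) (A B : Fm) :
      SProvable L ⟨A ::ₘ B ::ₘ Γ, Θ, Δ⟩ → SProvable L ⟨A.and B ::ₘ Γ, Θ, Δ⟩
  | andR (Γ : Multiset Fm) (Θ : Multiset Block) (Δ : Multiset Fm) (A B : Fm) :
      SProvable L ⟨Γ, Θ, A ::ₘ Δ⟩ → SProvable L ⟨Γ, Θ, B ::ₘ Δ⟩ →
      SProvable L ⟨Γ, Θ, A.and B ::ₘ Δ⟩
  | orL (Γ : Multiset Fm) (Θ : Multiset Block) (Δ : Multiset Fm) (A B : Fm) :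
      SProvable L ⟨A ::ₘ Γ, Θ, Δ⟩ → SProvable L ⟨B ::ₘ Γ, Θ, Δ⟩ →
      SProvable L ⟨A.or B ::ₘ Γ, Θ, Δ⟩
  | orR (Γ : Multiset Fm) (Θ : Multiset Block) (Δ : Multiset Fm) (A B : Fm) :
      SProvable L ⟨Γ, Θ, A ::ₘ B ::ₘ Δ⟩ → SProvable L ⟨Γ, Θ, A.or B ::ₘ Δ⟩
  | boxL (Γ : Multiset Fm) (Θ : Multiset Block) (Δ : Multiset Fm) (A : Fm) :
      SProvable L ⟨Γ, NEMultiset.single A ::ₘ Θ, Δ⟩ → SProvable L ⟨A.box ::ₘ Γ, Θ, Δ⟩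
  | boxR (Γ : Multiset Fm) (Θ : Multiset Block) (Δ : Multiset Fm) (S : Block) (B : Fm) :
      -- `Fm.top` is dropped because the labelled rule N introduces `τ ▷ x` without `τ ⊩∀ ⊤`, so `⊤`
      -- need not be derivable on the left at a member of the block.
      SProvable L ⟨S.1.filter (· ≠ Fm.top), 0, {B}⟩ →
      (L.hasM = false → ∀ A ∈ S.1, A ≠ Fm.top → SProvable L ⟨{B}, 0, {A}⟩) →
      SProvable L ⟨Γ, S ::ₘ Θ, B.box ::ₘ Δ⟩
  -- The boxed formula in the succedent guarantees the side condition of the labelled rule N, that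
  -- its world label occurs in the conclusion.
  | ruleN (hN : L.hasN = true) (Γ : Multiset Fm) (Θ : Multiset Block) (Δ : Multiset Fm) (B : Fm) :
      SProvable L ⟨Γ, NEMultiset.single Fm.top ::ₘ Θ, B.box ::ₘ Δ⟩ →
      SProvable L ⟨Γ, Θ, B.box ::ₘ Δ⟩
  | ruleC (hC : L.hasC = true) (Γ : Multiset Fm) (Θ : Multiset Block) (Δ : Multiset Fm)
      (S P : Block) :
      SProvable L ⟨Γ, S.add P ::ₘ Θ, Δ⟩ → SProvable L ⟨Γ, S ::ₘ P ::ₘ Θ, Δ⟩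

/-- Read bottom-up, the blocks of `K` are absorbed into `S` one at a time. Describing the final
block `T` by an equation lets `S` vary in the induction. -/
theorem SProvable.ruleC_sum {L : CubeSystem} (hC : L.hasC = true) (Γ : Multiset Fm)
    (Δ : Multiset Fm) (Θ K : Multiset Block) : ∀ S T : Block,
      T.1 = S.1 + blockUnion K → SProvable L ⟨Γ, T ::ₘ Θ, Δ⟩ →
      SProvable L ⟨Γ, S ::ₘ (K + Θ), Δ⟩ := by
  induction K using Multiset.induction_on with
  | empty =>
    intro S T hT h
    have : T = S := Subtype.ext (by simpa using hT)
    simpa [this] using h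
  | cons P K ih =>
    intro S T hT h
    rw [Multiset.cons_add]
    exact SProvable.ruleC hC _ _ _ _ _ (ih (S.add P) T (by simp [hT, add_assoc]) h)

/-! ## Completeness of the calculus for single sequents -/

/-- The size of a formula, where `⊤` does not count. -/
def Fm.size : Fm → ℕ
  | atom _ => 1
  | bot => 1
  -- Weight zero allows rule N to add the block `⟨⊤⟩` without raising the size on which completeness
  -- is proved by induction.
  | top => 0
  | and A B => A.size + B.size + 1
  | or A B => A.size + B.size + 1
  | imp A B => A.size + B.size + 1
  | box A => A.size + 1

/-- The size of a multiset of formulas. -/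
def fmSize (Γ : Multiset Fm) : ℕ := (Γ.map Fm.size).sum

@[simp] theorem fmSize_zero : fmSize 0 = 0 := rfl

@[simp] theorem fmSize_cons (A : Fm) (Γ : Multiset Fm) : fmSize (A ::ₘ Γ) = A.size + fmSize Γ := by
  simp [fmSize]

@[simp] theorem fmSize_singleton (A : Fm) : fmSize {A} = A.size := by simp [fmSize]

theorem fmSize_add (Γ Δ : Multiset Fm) : fmSize (Γ + Δ) = fmSize Γ + fmSize Δ := by simp [fmSize]

theorem fmSize_mono {Γ Δ : Multiset Fm} (h : Γ ≤ Δ) : fmSize Γ ≤ fmSize Δ := by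
  obtain ⟨Γ', rfl⟩ := Multiset.le_iff_exists_add.1 h
  simp [fmSize_add]

theorem size_le_fmSize {A : Fm} {Γ : Multiset Fm} (h : A ∈ Γ) : A.size ≤ fmSize Γ := by
  simpa using fmSize_mono (Multiset.singleton_le.2 h)

/-- The size of a multiset of blocks. -/
def blockSize (Θ : Multiset Block) : ℕ := fmSize (blockUnion Θ)

@[simp] theorem blockSize_cons (S : Block) (Θ : Multiset Block) :
    blockSize (S ::ₘ Θ) = fmSize S.1 + blockSize Θ := by
  simp [blockSize, fmSize_add]

theorem blockSize_mono {Θ Θ' : Multiset Block} (h : Θ ≤ Θ') : blockSize Θ ≤ blockSize Θ' := by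
  obtain ⟨Θ'', rfl⟩ := Multiset.le_iff_exists_add.1 h
  simp [blockSize, fmSize_add]

/-- The size of a sequent. -/
def Sequent.size (c : Sequent) : ℕ := fmSize c.ant + blockSize c.blocks + fmSize c.suc

/-- The sets of blocks that can be merged into a single block in the logic `L`. -/
def Mergeable (L : CubeSystem) (Θ K : Multiset Block) : Prop :=
  K ≤ Θ ∧ K ≠ 0 ∧ (L.hasC = true ∨ ∃ S, K = {S})

theorem NModel.mem_truthAll_sum {L : CubeSystem} (M : NModel L) (K : Multiset Block) (w : M.W) :
    w ∈ M.truthAll (blockUnion K) ↔ ∀ S ∈ K, w ∈ M.truthAll S.1 := by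
  simp only [truthAll, Set.mem_ofPred_eq]
  induction K using Multiset.induction_on with
  | empty => simp
  | cons S K ih => simp [or_imp, forall_and, ih]

open Classical in
/-- A valid sequent to which no propositional rule applies has a boxed formula in the succedent
that follows from some of the blocks. -/
theorem Sequent.Valid.exists_box {L : CubeSystem} {Γ Δ : Multiset Fm} {Θ : Multiset Block}
    (h : Sequent.Valid L ⟨Γ, Θ, Δ⟩)
    (hΓ : ∀ A ∈ Γ, A = Fm.top ∨ ∃ p, A = Fm.atom p)
    (hΔ : ∀ A ∈ Δ, A = Fm.bot ∨ (∃ p, A = Fm.atom p ∧ A ∉ Γ) ∨ ∃ B, A = Fm.box B)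
    {Θ' : Multiset Block} (hΘ : Θ ≤ Θ')
    (hN : L.hasN = true → NEMultiset.single Fm.top ∈ Θ') :
    ∃ B, Fm.box B ∈ Δ ∧ ∃ K, Mergeable L Θ' K ∧
      Sequent.Valid L ⟨(blockUnion K).filter (· ≠ Fm.top), 0, {B}⟩ ∧
      (L.hasM = false → ∀ A ∈ blockUnion K, Sequent.Valid L ⟨{B}, 0, {A}⟩) := by
  obtain ⟨U, -, hU⟩ := NModel.exists_universal L
  let T : Multiset Block → Set U.W := fun K => U.truthAll (blockUnion K)
  -- The neighbourhoods of the root: sets equal to some `T K` with `K` mergeable, or, in the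
  -- monotonic case, including one.
  let 𝒩 : Set (Set U.W) :=
    {X | ∃ K, Mergeable L Θ' K ∧ T K ⊆ X ∧ (L.hasM = false → X ⊆ T K)}
  have hT : ∀ K K' : Multiset Block, T (K ∪ K') = T K ∩ T K' := by
    intro K K'
    ext w
    simp only [T, U.mem_truthAll_sum, Multiset.mem_union, Set.mem_inter_iff]
    exact ⟨fun h => ⟨fun S hS => h S (.inl hS), fun S hS => h S (.inr hS)⟩,
      fun h S hS => hS.elim (h.1 S) (h.2 S)⟩
  have hTs : ∀ S : Block, T {S} = U.truthAll S.1 := by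
    intro S; simp [T]
  let R : NModel L := U.addRoot 𝒩 (fun p => Fm.atom p ∈ Γ)
    (by
      rintro hM X Y ⟨K, hK, hX, -⟩ hXY
      exact ⟨K, hK, hX.trans hXY, by simp [hM]⟩)
    (by
      rintro hC X Y ⟨K, hK, hX, hX'⟩ ⟨K', hK', hY, hY'⟩
      -- The union with maximal multiplicities stays below `Θ'`, where the sum might not; `T` does
      -- not depend on multiplicities.
      refine ⟨K ∪ K', ⟨Multiset.union_le hK.1 hK'.1, fun h0 => hK.2.1 ?_, .inl hC⟩, ?_, ?_⟩
      · exact Multiset.le_zero.1 (h0 ▸ Multiset.le_union_left)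
      · rw [hT]; exact Set.inter_subset_inter hX hY
      · intro hM; rw [hT]; exact Set.inter_subset_inter (hX' hM) (hY' hM))
    (by
      intro h
      refine ⟨{NEMultiset.single Fm.top}, ⟨by simpa using hN h, by simp, .inr ⟨_, rfl⟩⟩,
        Set.subset_univ _, fun _ w _ => ?_⟩
      rw [hTs]
      simp [NModel.truthAll, NEMultiset.single, NModel.truth])
  -- If no boxed formula follows from mergeable blocks, the root falsifies the sequent.
  by_contra hcon
  refine h R none ⟨?_, ?_, ?_⟩
  · intro A hA
    rcases hΓ A hA with rfl | ⟨p, rfl⟩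
    · exact Set.mem_univ _
    · exact hA
  · intro S hS
    change some ⁻¹' R.truthAll S.1 ∈ 𝒩
    rw [NModel.preimage_truthAll_addRoot, ← hTs]
    exact ⟨{S}, ⟨by simpa using Multiset.subset_of_le hΘ hS, by simp, .inr ⟨_, rfl⟩⟩, subset_rfl,
      fun _ => subset_rfl⟩
  · intro A hA
    rcases hΔ A hA with rfl | ⟨p, rfl, hp⟩ | ⟨B, rfl⟩
    · exact Set.notMem_empty _
    · exact hp
    · change some ⁻¹' R.truth B ∉ 𝒩
      rw [NModel.preimage_truth_addRoot]
      rintro ⟨K, hK, hB, hB'⟩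
      refine hcon ⟨B, hA, K, hK, ?_, ?_⟩
      -- `U` falsifies every invalid sequent, so an inclusion of truth sets in `U` already yields
      -- validity.
      · by_contra hv
        obtain ⟨w, hw⟩ := hU _ hv
        refine hw.2.2 B (Multiset.mem_singleton_self B) (hB fun A hA => ?_)
        by_cases hAt : A = Fm.top
        · rw [hAt]; exact Set.mem_univ _
        · exact hw.1 A (Multiset.mem_filter.2 ⟨hA, hAt⟩)
      · intro hM A hA
        by_contra hv
        obtain ⟨w, hw⟩ := hU _ hv
        exact hw.2.2 A (Multiset.mem_singleton_self A)
          (hB' hM (hw.1 B (Multiset.mem_singleton_self B)) A hA)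

-- A single block is ready for the box rule; several blocks are first merged by rule C, which the
-- mergeability condition then provides.
open Classical in
theorem SProvable.of_mergeable {L : CubeSystem} {Γ Δ : Multiset Fm} {Θ K : Multiset Block} {B : Fm}
    (hK : Mergeable L Θ K)
    (h₁ : SProvable L ⟨(blockUnion K).filter (· ≠ Fm.top), 0, {B}⟩)
    (h₂ : L.hasM = false → ∀ A ∈ blockUnion K, A ≠ Fm.top → SProvable L ⟨{B}, 0, {A}⟩) :
    SProvable L ⟨Γ, Θ, B.box ::ₘ Δ⟩ := by
  obtain ⟨hKΘ, hK0, hC⟩ := hK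
  obtain ⟨Θ, rfl⟩ := Multiset.le_iff_exists_add.1 hKΘ
  rcases hC with hC | ⟨S, rfl⟩
  · obtain ⟨S, hS⟩ := Multiset.exists_mem_of_ne_zero hK0
    obtain ⟨K, rfl⟩ := Multiset.exists_cons_of_mem hS
    have hne : blockUnion (S ::ₘ K) ≠ 0 := by
      simp [S.2]
    rw [Multiset.cons_add]
    exact SProvable.ruleC_sum hC _ _ _ _ _ ⟨_, hne⟩ (by simp) (SProvable.boxR _ _ _ _ _ h₁ h₂)
  · rw [blockUnion_singleton] at h₁ h₂
    exact SProvable.boxR _ _ _ _ _ h₁ h₂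

-- Induction on the size. The propositional rules and the left box rule are semantically invertible
-- and have smaller premisses. When none of them applies, `Sequent.Valid.exists_box` supplies valid
-- premisses for the right box rule; these lose the weight of the box.
open Classical in
theorem SProvable.of_valid {L : CubeSystem} {c : Sequent} (h : c.Valid L) : SProvable L c := by
  induction hn : c.size using Nat.strong_induction_on generalizing c with
  | _ n ih =>
  have ih' : ∀ c' : Sequent, c'.size < c.size → c'.Valid L → SProvable L c' :=
    fun c' hlt hv => ih _ (hn ▸ hlt) hv rfl
  clear ih hn
  obtain ⟨Γ, Θ, Δ⟩ := c
  by_cases hΓ : ∀ A ∈ Γ, A = Fm.top ∨ ∃ p, A = Fm.atom p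
  · by_cases hΔ : ∀ A ∈ Δ, A = Fm.bot ∨ (∃ p, A = Fm.atom p ∧ A ∉ Γ) ∨ ∃ B, A = Fm.box B
    -- `Θ'` is `Θ`, enlarged by `⟨⊤⟩` if the logic has N. As the size is unchanged, the induction
    -- hypothesis still covers the premisses of the right box rule.
    · have key : ∀ Θ', Θ ≤ Θ' → (L.hasN = true → NEMultiset.single Fm.top ∈ Θ') →
          blockSize Θ' = blockSize Θ → ∃ B Δ', Δ = Fm.box B ::ₘ Δ' ∧ SProvable L ⟨Γ, Θ', Δ⟩ := by
        intro Θ' hΘ hN hs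
        obtain ⟨B, hB, K, hK, h₁, h₂⟩ := h.exists_box hΓ hΔ hΘ hN
        obtain ⟨Δ, rfl⟩ := Multiset.exists_cons_of_mem hB
        have hKs : fmSize (blockUnion K) ≤ blockSize Θ := hs ▸ blockSize_mono hK.1
        refine ⟨B, Δ, rfl, SProvable.of_mergeable hK (ih' _ ?_ h₁) fun hM A hA _ =>
          ih' _ ?_ (h₂ hM A hA)⟩
        · have := fmSize_mono (Multiset.filter_le (· ≠ Fm.top) (blockUnion K))
          simp only [Sequent.size, fmSize_cons, Fm.size, fmSize_singleton,
            show blockSize 0 = 0 from rfl]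
          omega
        · have := size_le_fmSize hA
          simp only [Sequent.size, fmSize_cons, Fm.size, fmSize_singleton,
            show blockSize 0 = 0 from rfl]
          omega
      by_cases hN : L.hasN = true
      · obtain ⟨B, Δ, rfl, h⟩ := key (NEMultiset.single Fm.top ::ₘ Θ) (Multiset.le_cons_self _ _)
          (by simp) (by simp [Fm.size])
        exact SProvable.ruleN hN _ _ _ _ h
      · obtain ⟨B, Δ, rfl, h⟩ := key Θ le_rfl (by simp [hN]) rfl
        exact h
    · push Not at hΔ
      obtain ⟨A, hA, hbot, hatom, hbox⟩ := hΔ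
      obtain ⟨Δ, rfl⟩ := Multiset.exists_cons_of_mem hA
      cases A with
      | atom p =>
        obtain ⟨Γ, rfl⟩ := Multiset.exists_cons_of_mem (hatom p rfl)
        exact SProvable.ax _ _ _ _
      | bot => exact absurd rfl hbot
      | top => exact SProvable.topR _ _ _
      | and A B =>
        refine SProvable.andR _ _ _ _ _
          (ih' _ (by simp [Sequent.size, Fm.size]) fun M w hf => h M w ?_)
          (ih' _ (by simp [Sequent.size, Fm.size]) fun M w hf => h M w ?_)
        all_goals
          simp only [NModel.Falsifies, Multiset.mem_cons, forall_eq_or_imp, NModel.truth] at hf ⊢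
          simp; tauto
      | or A B =>
        refine SProvable.orR _ _ _ _ _
          (ih' _ (by simp [Sequent.size, Fm.size]; omega) fun M w hf => h M w ?_)
        simp only [NModel.Falsifies, Multiset.mem_cons, forall_eq_or_imp, NModel.truth] at hf ⊢
        simp; tauto
      | imp A B =>
        refine SProvable.impR _ _ _ _ _
          (ih' _ (by simp [Sequent.size, Fm.size]; omega) fun M w hf => h M w ?_)
        simp only [NModel.Falsifies, Multiset.mem_cons, forall_eq_or_imp, NModel.truth] at hf ⊢
        simp; tauto
      | box B => exact absurd rfl (hbox B)
  · push Not at hΓ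
    obtain ⟨A, hA, htop, hatom⟩ := hΓ
    obtain ⟨Γ, rfl⟩ := Multiset.exists_cons_of_mem hA
    cases A with
    | atom p => exact absurd rfl (hatom p)
    | bot => exact SProvable.botL _ _ _
    | top => exact absurd rfl htop
    | and A B =>
      refine SProvable.andL _ _ _ _ _
        (ih' _ (by simp [Sequent.size, Fm.size]; omega) fun M w hf => h M w ?_)
      simp only [NModel.Falsifies, Multiset.mem_cons, forall_eq_or_imp, NModel.truth] at hf ⊢
      simp; tauto
    | or A B =>
      refine SProvable.orL _ _ _ _ _
        (ih' _ (by simp [Sequent.size, Fm.size]) fun M w hf => h M w ?_)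
        (ih' _ (by simp [Sequent.size, Fm.size]) fun M w hf => h M w ?_)
      all_goals
        simp only [NModel.Falsifies, Multiset.mem_cons, forall_eq_or_imp, NModel.truth] at hf ⊢
        simp; tauto
    | imp A B =>
      refine SProvable.impL _ _ _ _ _
        (ih' _ (by simp [Sequent.size, Fm.size]; omega) fun M w hf => h M w ?_)
        (ih' _ (by simp [Sequent.size, Fm.size]) fun M w hf => h M w ?_)
      all_goals
        simp only [NModel.Falsifies, Multiset.mem_cons, forall_eq_or_imp, NModel.truth] at hf ⊢
        simp; tauto
    | box A =>
      refine SProvable.boxL _ _ _ _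
        (ih' _ (by simp [Sequent.size, Fm.size]; omega)
          fun M w hf => h M w ?_)
      have : M.truthAll (NEMultiset.single A).1 = M.truth A := by
        ext v; simp [NModel.truthAll, NEMultiset.single]
      simp only [NModel.Falsifies, Multiset.mem_cons, forall_eq_or_imp, NModel.truth, this] at hf ⊢
      simp; tauto

/-! ## The hypersequent calculus -/

/-- In a provable hypersequent some component is valid. -/
theorem HProvable.exists_valid {L : CubeSystem} {H : Hypersequent} (h : HProvable L H) :
    ∃ c ∈ H, c.Valid L := by
  -- For a one-premiss rule acting inside a component, it suffices that each falsifying world of the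
  -- conclusion falsifies the premiss; `step₂` is the analogue with a choice between two premisses.
  have step : ∀ {c c' : Sequent} {G : Hypersequent},
      (∀ (M : NModel L) w, M.Falsifies w c → M.Falsifies w c') →
      (∃ d ∈ c' ::ₘ G, d.Valid L) → ∃ d ∈ c ::ₘ G, d.Valid L := by
    rintro c c' G hcc ⟨d, hd, hv⟩
    rcases Multiset.mem_cons.1 hd with rfl | hd
    · exact ⟨c, by simp, fun M w hf => hv M w (hcc M w hf)⟩
    · exact ⟨d, by simp [hd], hv⟩
  have step₂ : ∀ {c c₁ c₂ : Sequent} {G : Hypersequent},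
      (∀ (M : NModel L) w, M.Falsifies w c → M.Falsifies w c₁ ∨ M.Falsifies w c₂) →
      (∃ d ∈ c₁ ::ₘ G, d.Valid L) → (∃ d ∈ c₂ ::ₘ G, d.Valid L) → ∃ d ∈ c ::ₘ G, d.Valid L := by
    rintro c c₁ c₂ G hcc ⟨d, hd, hv⟩ ⟨d', hd', hv'⟩
    rcases Multiset.mem_cons.1 hd with rfl | hd
    · rcases Multiset.mem_cons.1 hd' with rfl | hd'
      · exact ⟨c, by simp, fun M w hf => (hcc M w hf).elim (hv M w) (hv' M w)⟩
      · exact ⟨d', by simp [hd'], hv'⟩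
    · exact ⟨d, by simp [hd], hv⟩
  induction h with
  | ax G Γ Θ Δ p =>
    refine ⟨_, Multiset.mem_cons_self _ _, fun M w hf => hf.2.2 (Fm.atom p) (by simp) ?_⟩
    exact hf.1 _ (by simp)
  | botL G Γ Θ Δ => exact ⟨_, Multiset.mem_cons_self _ _, fun M w hf => hf.1 Fm.bot (by simp)⟩
  | topR G Γ Θ Δ =>
    exact ⟨_, Multiset.mem_cons_self _ _, fun M w hf => hf.2.2 Fm.top (by simp) (Set.mem_univ _)⟩
  | impL G Γ Θ Δ A B _ _ h₁ h₂ =>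
    refine step₂ (fun M w hf => ?_) h₁ h₂
    simp only [NModel.Falsifies, Multiset.mem_cons, forall_eq_or_imp, NModel.truth,
      Set.mem_ofPred_eq] at hf ⊢
    tauto
  | impR G Γ Θ Δ A B _ h₁ =>
    refine step (fun M w hf => ?_) h₁
    simp only [NModel.Falsifies, Multiset.mem_cons, forall_eq_or_imp, NModel.truth,
      Set.mem_ofPred_eq] at hf ⊢
    tauto
  | andL G Γ Θ Δ A B _ h₁ =>
    refine step (fun M w hf => ?_) h₁
    simp only [NModel.Falsifies, Multiset.mem_cons, forall_eq_or_imp, NModel.truth,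
      Set.mem_inter_iff] at hf ⊢
    tauto
  | andR G Γ Θ Δ A B _ _ h₁ h₂ =>
    refine step₂ (fun M w hf => ?_) h₁ h₂
    simp only [NModel.Falsifies, Multiset.mem_cons, forall_eq_or_imp, NModel.truth,
      Set.mem_inter_iff] at hf ⊢
    tauto
  | orL G Γ Θ Δ A B _ _ h₁ h₂ =>
    refine step₂ (fun M w hf => ?_) h₁ h₂
    simp only [NModel.Falsifies, Multiset.mem_cons, forall_eq_or_imp, NModel.truth,
      Set.mem_union] at hf ⊢
    tauto
  | orR G Γ Θ Δ A B _ h₁ =>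
    refine step (fun M w hf => ?_) h₁
    simp only [NModel.Falsifies, Multiset.mem_cons, forall_eq_or_imp, NModel.truth,
      Set.mem_union] at hf ⊢
    tauto
  | boxL G Γ Θ Δ A _ h₁ =>
    refine step (fun M w hf => ?_) h₁
    have : M.truthAll (NEMultiset.single A).1 = M.truth A := by
      ext v; simp [NModel.truthAll, NEMultiset.single]
    simp only [NModel.Falsifies, Multiset.mem_cons, forall_eq_or_imp, NModel.truth, this,
      Set.mem_ofPred_eq] at hf ⊢
    tauto
  | boxR hM G Γ Θ Δ S B _ _ h₁ h₂ =>
    -- Otherwise the valid component of each premiss must be the newly created one, and together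
    -- these give `B` the same truth set as the block.
    by_cases hG : ∃ d ∈ (⟨Γ, S ::ₘ Θ, B.box ::ₘ Δ⟩ : Sequent) ::ₘ G, d.Valid L
    · exact hG
    · have hS : ∀ {c : Sequent}, (∃ d ∈ c ::ₘ (⟨Γ, S ::ₘ Θ, B.box ::ₘ Δ⟩ : Sequent) ::ₘ G,
          d.Valid L) → c.Valid L := by
        rintro c ⟨d, hd, hv⟩
        rcases Multiset.mem_cons.1 hd with rfl | hd
        · exact hv
        · exact absurd ⟨d, hd, hv⟩ hG
      refine ⟨_, Multiset.mem_cons_self _ _, fun M w hf => hf.2.2 B.box (by simp) ?_⟩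
      have : M.truth B = M.truthAll S.1 := by
        ext v
        constructor
        · intro hv A hA
          by_contra hn
          exact hS (h₂ A hA) M v (by simp [NModel.Falsifies, hv, hn])
        · intro hv
          by_contra hn
          exact hS h₁ M v (by simpa [NModel.Falsifies, hn, NModel.truthAll] using hv)
      change M.truth B ∈ M.N w
      rw [this]
      exact hf.2.1 S (by simp)
  | boxRM hM G Γ Θ Δ S B _ h₁ =>
    obtain ⟨d, hd, hv⟩ := h₁
    rcases Multiset.mem_cons.1 hd with rfl | hd
    · refine ⟨_, Multiset.mem_cons_self _ _, fun M w hf => hf.2.2 B.box (by simp) ?_⟩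
      refine M.mono hM w _ _ (hf.2.1 S (by simp)) fun v hv' => ?_
      by_contra hn
      exact hv M v (by simpa [NModel.Falsifies, hn, NModel.truthAll] using hv')
    · exact ⟨d, hd, hv⟩
  | ruleN hN G Γ Θ Δ _ h₁ =>
    refine step (c' := ⟨Γ, NEMultiset.single Fm.top ::ₘ Θ, Δ⟩)
      (fun M w hf => ⟨hf.1, ?_, hf.2.2⟩) h₁
    have : M.truthAll (NEMultiset.single Fm.top).1 = Set.univ := by
      ext v; simp [NModel.truthAll, NEMultiset.single, NModel.truth]
    intro Q hQ
    rcases Multiset.mem_cons.1 hQ with rfl | hQ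
    · rw [this]
      exact M.univ hN w
    · exact hf.2.1 Q hQ
  | ruleC hC G Γ Θ Δ S P _ h₁ =>
    refine step (c' := ⟨Γ, S.add P ::ₘ S ::ₘ P ::ₘ Θ, Δ⟩)
      (fun M w hf => ⟨hf.1, ?_, hf.2.2⟩) h₁
    have : M.truthAll (S.add P).1 = M.truthAll S.1 ∩ M.truthAll P.1 := by
      ext v; simp [NModel.truthAll, or_imp, forall_and]
    intro Q hQ
    rcases Multiset.mem_cons.1 hQ with rfl | hQ
    · rw [this]
      exact M.inter hC w _ _ (hf.2.1 S (by simp)) (hf.2.1 P (by simp))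
    · exact hf.2.1 Q hQ

open Classical in
/-- A hypersequent is provable if one of its components extends a provable sequent. -/
theorem SProvable.hProvable {L : CubeSystem} {c : Sequent} (h : SProvable L c) :
    ∀ (G : Hypersequent) (Γ : Multiset Fm) (Θ : Multiset Block) (Δ : Multiset Fm),
      c.ant ≤ Γ → c.blocks ≤ Θ → c.suc ≤ Δ → HProvable L (⟨Γ, Θ, Δ⟩ ::ₘ G) := by
  induction h with
  | ax Γ Θ Δ p =>
    intro G Γ' Θ' Δ' hΓ hΘ hΔ
    obtain ⟨Γ', rfl, -⟩ := Multiset.exists_cons_of_cons_le hΓ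
    obtain ⟨Δ', rfl, -⟩ := Multiset.exists_cons_of_cons_le hΔ
    exact HProvable.ax _ _ _ _ _
  | botL Γ Θ Δ =>
    intro G Γ' Θ' Δ' hΓ hΘ hΔ
    obtain ⟨Γ', rfl, -⟩ := Multiset.exists_cons_of_cons_le hΓ
    exact HProvable.botL _ _ _ _
  | topR Γ Θ Δ =>
    intro G Γ' Θ' Δ' hΓ hΘ hΔ
    obtain ⟨Δ', rfl, -⟩ := Multiset.exists_cons_of_cons_le hΔ
    exact HProvable.topR _ _ _ _
  | impL Γ Θ Δ A B _ _ h₁ h₂ =>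
    intro G Γ' Θ' Δ' hΓ hΘ hΔ
    obtain ⟨Γ', rfl, hΓ₁⟩ := Multiset.exists_cons_of_cons_le hΓ
    -- The principal formula repeated by the cumulative rule is absorbed as weakening, here and in
    -- the cases below.
    have hΓ' := hΓ₁.trans (Multiset.le_cons_self Γ' (A.imp B))
    exact HProvable.impL _ _ _ _ _ _ (h₁ _ _ _ _ hΓ' hΘ (Multiset.cons_le_cons _ hΔ))
      (h₂ _ _ _ _ (Multiset.cons_le_cons _ hΓ') hΘ hΔ)
  | impR Γ Θ Δ A B _ h₁ =>
    intro G Γ' Θ' Δ' hΓ hΘ hΔ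
    obtain ⟨Δ', rfl, hΔ₁⟩ := Multiset.exists_cons_of_cons_le hΔ
    have hΔ' := hΔ₁.trans (Multiset.le_cons_self Δ' (A.imp B))
    exact HProvable.impR _ _ _ _ _ _
      (h₁ _ _ _ _ (Multiset.cons_le_cons _ hΓ) hΘ (Multiset.cons_le_cons _ hΔ'))
  | andL Γ Θ Δ A B _ h₁ =>
    intro G Γ' Θ' Δ' hΓ hΘ hΔ
    obtain ⟨Γ', rfl, hΓ₁⟩ := Multiset.exists_cons_of_cons_le hΓ
    have hΓ' := hΓ₁.trans (Multiset.le_cons_self Γ' (A.and B))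
    exact HProvable.andL _ _ _ _ _ _
      (h₁ _ _ _ _ (Multiset.cons_le_cons _ (Multiset.cons_le_cons _ hΓ')) hΘ hΔ)
  | andR Γ Θ Δ A B _ _ h₁ h₂ =>
    intro G Γ' Θ' Δ' hΓ hΘ hΔ
    obtain ⟨Δ', rfl, hΔ₁⟩ := Multiset.exists_cons_of_cons_le hΔ
    have hΔ' := hΔ₁.trans (Multiset.le_cons_self Δ' (A.and B))
    exact HProvable.andR _ _ _ _ _ _ (h₁ _ _ _ _ hΓ hΘ (Multiset.cons_le_cons _ hΔ'))
      (h₂ _ _ _ _ hΓ hΘ (Multiset.cons_le_cons _ hΔ'))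
  | orL Γ Θ Δ A B _ _ h₁ h₂ =>
    intro G Γ' Θ' Δ' hΓ hΘ hΔ
    obtain ⟨Γ', rfl, hΓ₁⟩ := Multiset.exists_cons_of_cons_le hΓ
    have hΓ' := hΓ₁.trans (Multiset.le_cons_self Γ' (A.or B))
    exact HProvable.orL _ _ _ _ _ _ (h₁ _ _ _ _ (Multiset.cons_le_cons _ hΓ') hΘ hΔ)
      (h₂ _ _ _ _ (Multiset.cons_le_cons _ hΓ') hΘ hΔ)
  | orR Γ Θ Δ A B _ h₁ =>
    intro G Γ' Θ' Δ' hΓ hΘ hΔ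
    obtain ⟨Δ', rfl, hΔ₁⟩ := Multiset.exists_cons_of_cons_le hΔ
    have hΔ' := hΔ₁.trans (Multiset.le_cons_self Δ' (A.or B))
    exact HProvable.orR _ _ _ _ _ _
      (h₁ _ _ _ _ hΓ hΘ (Multiset.cons_le_cons _ (Multiset.cons_le_cons _ hΔ')))
  | boxL Γ Θ Δ A _ h₁ =>
    intro G Γ' Θ' Δ' hΓ hΘ hΔ
    obtain ⟨Γ', rfl, hΓ₁⟩ := Multiset.exists_cons_of_cons_le hΓ
    have hΓ' := hΓ₁.trans (Multiset.le_cons_self Γ' A.box)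
    exact HProvable.boxL _ _ _ _ _ (h₁ _ _ _ _ hΓ' (Multiset.cons_le_cons _ hΘ) hΔ)
  | boxR Γ Θ Δ S B _ _ h₁ h₂ =>
    intro G Γ' Θ' Δ' hΓ hΘ hΔ
    obtain ⟨Δ', rfl, hΔ₁⟩ := Multiset.exists_cons_of_cons_le hΔ
    obtain ⟨Θ', rfl, hΘ₁⟩ := Multiset.exists_cons_of_cons_le hΘ
    have h₁' := fun G => h₁ G _ _ _ (Multiset.filter_le _ _) le_rfl le_rfl
    by_cases hM : L.hasM = true
    · exact HProvable.boxRM hM _ _ _ _ _ _ (h₁' _)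
    · rw [Bool.not_eq_true] at hM
      refine HProvable.boxR hM _ _ _ _ _ _ (h₁' _) fun A hA => ?_
      -- The premiss `B ⇒ ⊤` omitted in `SProvable` is an initial hypersequent.
      by_cases hAt : A = Fm.top
      · subst hAt
        exact HProvable.topR _ _ _ 0
      · exact h₂ hM A hA hAt _ _ _ _ le_rfl le_rfl le_rfl
  | ruleN hN Γ Θ Δ B _ h₁ =>
    intro G Γ' Θ' Δ' hΓ hΘ hΔ
    exact HProvable.ruleN hN _ _ _ _ (h₁ _ _ _ _ hΓ (Multiset.cons_le_cons _ hΘ) hΔ)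
  | ruleC hC Γ Θ Δ S P _ h₁ =>
    intro G Γ' Θ' Δ' hΓ hΘ hΔ
    obtain ⟨Θ', rfl, hΘ₁⟩ := Multiset.exists_cons_of_cons_le hΘ
    obtain ⟨Θ', rfl, hΘ₂⟩ := Multiset.exists_cons_of_cons_le hΘ₁
    refine HProvable.ruleC hC _ _ _ _ _ _ (h₁ _ _ _ _ hΓ (Multiset.cons_le_cons _ ?_) hΔ)
    exact hΘ₂.trans ((Multiset.le_cons_self _ _).trans (Multiset.le_cons_self _ _))

theorem hProvable_iff_exists_valid {L : CubeSystem} {H : Hypersequent} :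
    HProvable L H ↔ ∃ c ∈ H, c.Valid L := by
  refine ⟨HProvable.exists_valid, ?_⟩
  rintro ⟨c, hc, hv⟩
  obtain ⟨G, rfl⟩ := Multiset.exists_cons_of_mem hc
  exact (SProvable.of_valid hv).hProvable G _ _ _ le_rfl le_rfl le_rfl

/-! ## Soundness of the labelled calculus -/

/-- The interpretation of the constituents of neighbourhood terms. -/
def NLabel.val {W : Type} (ν : ℕ → Set W) : NLabel → Set W
  | var a => ν a
  | tau => Set.univ

/-- The interpretation of positive neighbourhood terms. -/
def termVal {W : Type} (ν : ℕ → Set W) (t : Term) : Set W := {w | ∀ a ∈ t.1, w ∈ a.val ν}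

/-- The truth of labelled formulas.  In the monotonic case negative terms are empty. -/
def LFm.Holds {L : CubeSystem} (M : NModel L) (ρ : WLabel → M.W) (ν : ℕ → Set M.W) : LFm → Prop
  | holds x A => ρ x ∈ M.truth A
  | all t A => termVal ν t ⊆ M.truth A
  | ex t A => L.hasM = false ∧ ∃ w ∉ termVal ν t, w ∈ M.truth A
  | mem x (STerm.pos t) => ρ x ∈ termVal ν t
  | mem x (STerm.neg t) => L.hasM = false ∧ ρ x ∉ termVal ν t
  | nbhd t x => termVal ν t ∈ M.N (ρ x)

theorem termVal_single {W : Type} (ν : ℕ → Set W) (a : NLabel) :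
    termVal ν (NEMultiset.single a) = a.val ν := by
  ext w; simp [termVal]

theorem termVal_add {W : Type} (ν : ℕ → Set W) (t s : Term) :
    termVal ν (t.add s) = termVal ν t ∩ termVal ν s := by
  ext w; simp [termVal, or_imp, forall_and]

theorem termVal_update {W : Type} (ν : ℕ → Set W) {a : ℕ} (X : Set W) {t : Term}
    (h : NLabel.var a ∉ t.1) : termVal (Function.update ν a X) t = termVal ν t := by
  ext w
  refine forall₂_congr fun b hb => ?_
  cases b with
  | tau => rfl
  | var b =>
    have : b ≠ a := fun e => h (e ▸ hb)
    simp [NLabel.val, Function.update_of_ne this]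

section Update

variable {L : CubeSystem} {M : NModel L} {ρ : WLabel → M.W} {ν : ℕ → Set M.W}

theorem LFm.holds_update_world {x : WLabel} (w : M.W) {φ : LFm} (h : ¬ φ.WorldOccurs x) :
    φ.Holds M (Function.update ρ x w) ν ↔ φ.Holds M ρ ν := by
  rcases φ with ⟨y, A⟩ | ⟨t, A⟩ | ⟨t, A⟩ | ⟨y, t | t⟩ | ⟨t, y⟩
  all_goals first
    | exact Iff.rfl
    | simp only [LFm.Holds, Function.update_of_ne (show y ≠ x from h)]

theorem LFm.holds_update_nbhd {a : ℕ} (X : Set M.W) {φ : LFm} (h : ¬ φ.NbhdOccurs a) :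
    φ.Holds M ρ (Function.update ν a X) ↔ φ.Holds M ρ ν := by
  rcases φ with ⟨y, A⟩ | ⟨t, A⟩ | ⟨t, A⟩ | ⟨y, t | t⟩ | ⟨t, y⟩
  all_goals first
    | exact Iff.rfl
    | simp only [LFm.Holds, termVal_update ν X (show NLabel.var a ∉ t.1 from h)]

end Update

theorem LProvable.sound {L : CubeSystem} {S : LSequent} (h : LProvable L S) (M : NModel L) :
    ∀ (ρ : WLabel → M.W) (ν : ℕ → Set M.W), (∀ φ ∈ S.ant, φ.Holds M ρ ν) →
      ∃ φ ∈ S.suc, φ.Holds M ρ ν := by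
  induction h with
  | ax Γ Δ x p => exact fun ρ ν h => ⟨_, Multiset.mem_cons_self _ _, h _ (by simp)⟩
  | botL Γ Δ x => exact fun ρ ν h => absurd (h _ (Multiset.mem_cons_self _ _)) (Set.notMem_empty _)
  | topR Γ Δ x => exact fun ρ ν h => ⟨_, Multiset.mem_cons_self _ _, Set.mem_univ _⟩
  | impL Γ Δ x A B _ _ h₁ h₂ =>
    intro ρ ν h
    have h₁ := h₁ ρ ν
    have h₂ := h₂ ρ ν
    simp only [Multiset.mem_cons, forall_eq_or_imp, exists_eq_or_imp, LFm.Holds, NModel.truth,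
      Set.mem_ofPred_eq] at h h₁ h₂ ⊢
    tauto
  | impR Γ Δ x A B _ h₁ =>
    intro ρ ν h
    have h₁ := h₁ ρ ν
    simp only [Multiset.mem_cons, forall_eq_or_imp, exists_eq_or_imp, LFm.Holds, NModel.truth,
      Set.mem_ofPred_eq] at h h₁ ⊢
    tauto
  | andL Γ Δ x A B _ h₁ =>
    intro ρ ν h
    have h₁ := h₁ ρ ν
    simp only [Multiset.mem_cons, forall_eq_or_imp, LFm.Holds, NModel.truth,
      Set.mem_inter_iff] at h h₁ ⊢
    tauto
  | andR Γ Δ x A B _ _ h₁ h₂ =>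
    intro ρ ν h
    have h₁ := h₁ ρ ν
    have h₂ := h₂ ρ ν
    simp only [Multiset.mem_cons, exists_eq_or_imp, LFm.Holds, NModel.truth,
      Set.mem_inter_iff] at h h₁ h₂ ⊢
    tauto
  | orL Γ Δ x A B _ _ h₁ h₂ =>
    intro ρ ν h
    have h₁ := h₁ ρ ν
    have h₂ := h₂ ρ ν
    simp only [Multiset.mem_cons, forall_eq_or_imp, LFm.Holds, NModel.truth,
      Set.mem_union] at h h₁ h₂ ⊢
    tauto
  | orR Γ Δ x A B _ h₁ =>
    intro ρ ν h
    have h₁ := h₁ ρ ν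
    simp only [Multiset.mem_cons, exists_eq_or_imp, LFm.Holds, NModel.truth,
      Set.mem_union] at h h₁ ⊢
    tauto
  | boxL Γ Δ x A a hΓ hΔ _ h₁ =>
    intro ρ ν h
    -- The fresh label is reinterpreted as the truth set of `A`, which makes `ā ⊩∃ A` false.
    have hv : termVal (Function.update ν a (M.truth A)) (NEMultiset.single (NLabel.var a)) =
        M.truth A := by simp [termVal_single, NLabel.val]
    obtain ⟨φ, hφ, hh⟩ := h₁ ρ (Function.update ν a (M.truth A)) (by
      intro φ hφ
      rcases Multiset.mem_cons.1 hφ with rfl | hφ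
      · change termVal _ _ ∈ _
        rw [hv]
        exact h (LFm.holds x A.box) (Multiset.mem_cons_self _ _)
      rcases Multiset.mem_cons.1 hφ with rfl | hφ
      · exact hv.subset
      · exact (LFm.holds_update_nbhd _ fun ho => hΓ ⟨φ, hφ, ho⟩).2
          (h φ (Multiset.mem_cons_of_mem hφ)))
    rcases Multiset.mem_cons.1 hφ with rfl | hφ
    · obtain ⟨-, w, hw, hw'⟩ := hh
      rw [hv] at hw
      exact absurd hw' hw
    · exact ⟨φ, hφ, (LFm.holds_update_nbhd _ fun ho => hΔ ⟨φ, hφ, ho⟩).1 hh⟩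
  | boxR Γ Δ x A t _ _ h₁ h₂ =>
    intro ρ ν h
    by_contra hn
    have hA : M.truth A ∉ M.N (ρ x) :=
      fun hA => hn ⟨LFm.holds x A.box, Multiset.mem_cons_self _ _, hA⟩
    have ht : termVal ν t ∈ M.N (ρ x) := h _ (Multiset.mem_cons_self _ _)
    obtain ⟨φ, hφ, hh⟩ := h₁ ρ ν h
    rcases Multiset.mem_cons.1 hφ with rfl | hφ
    · have hs : termVal ν t ⊆ M.truth A := hh
      -- The first premiss gives an inclusion, enough under monotonicity. Otherwise equality is
      -- excluded, so `A` holds somewhere outside `t` and the second premiss applies.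
      by_cases hM : L.hasM = true
      · exact hA (M.mono hM _ _ _ ht hs)
      · refine hn (h₂ ρ ν fun φ hφ => ?_)
        rcases Multiset.mem_cons.1 hφ with rfl | hφ
        · exact ht
        rcases Multiset.mem_cons.1 hφ with rfl | hφ
        · refine ⟨by simpa using hM, ?_⟩
          by_contra hc
          refine hA ?_
          have : termVal ν t = M.truth A := hs.antisymm fun w hw => by
            by_contra hwt
            exact hc ⟨w, hwt, hw⟩
          exact this ▸ ht
        · exact h φ (Multiset.mem_cons_of_mem hφ)
    · exact hn ⟨φ, hφ, hh⟩
  | ruleM hM Γ Δ x y t =>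
    intro ρ ν h
    have := (h (LFm.mem y (STerm.neg t)) (by simp)).1
    simp [hM] at this
  | ruleN hN Γ Δ x _ _ h₁ =>
    intro ρ ν h
    refine h₁ ρ ν fun φ hφ => ?_
    rcases Multiset.mem_cons.1 hφ with rfl | hφ
    · change termVal _ _ ∈ _
      rw [termVal_single]
      exact M.univ hN _
    · exact h φ hφ
  | ruleC hC Γ Δ x t s _ h₁ =>
    intro ρ ν h
    refine h₁ ρ ν fun φ hφ => ?_
    rcases Multiset.mem_cons.1 hφ with rfl | hφ
    · change termVal _ _ ∈ _
      rw [termVal_add]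
      exact M.inter hC _ _ _ (h (LFm.nbhd t x) (by simp)) (h (LFm.nbhd s x) (by simp))
    · exact h φ hφ
  | allL Γ Δ x A t _ h₁ =>
    intro ρ ν h
    have h₁ := h₁ ρ ν
    simp only [Multiset.mem_cons, forall_eq_or_imp, LFm.Holds] at h h₁ ⊢
    exact h₁ ⟨h.1, h.2.1 h.1, h.2⟩
  | allR Γ Δ y A t hΓ hΔ _ h₁ =>
    intro ρ ν h
    by_contra hn
    refine hn ⟨_, Multiset.mem_cons_self _ _, fun w hw => ?_⟩
    obtain ⟨φ, hφ, hh⟩ := h₁ (Function.update ρ y w) ν (by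
      intro φ hφ
      rcases Multiset.mem_cons.1 hφ with rfl | hφ
      · simpa [LFm.Holds] using hw
      · exact (LFm.holds_update_world _ fun ho => hΓ ⟨φ, hφ, ho⟩).2 (h φ hφ))
    rcases Multiset.mem_cons.1 hφ with rfl | hφ
    · simpa [LFm.Holds] using hh
    · exact absurd ⟨φ, Multiset.mem_cons_of_mem hφ,
        (LFm.holds_update_world _ fun ho => hΔ ⟨φ, hφ, ho⟩).1 hh⟩ hn
  | exL Γ Δ y A t hΓ hΔ _ h₁ =>
    intro ρ ν h
    obtain ⟨hM, w, hw, hwA⟩ := h _ (Multiset.mem_cons_self _ _)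
    obtain ⟨φ, hφ, hh⟩ := h₁ (Function.update ρ y w) ν (by
      intro φ hφ
      rcases Multiset.mem_cons.1 hφ with rfl | hφ
      · simpa [LFm.Holds, hM] using hw
      rcases Multiset.mem_cons.1 hφ with rfl | hφ
      · simpa [LFm.Holds] using hwA
      · exact (LFm.holds_update_world _ fun ho => hΓ ⟨φ, hφ, ho⟩).2
          (h φ (Multiset.mem_cons_of_mem hφ)))
    exact ⟨φ, hφ, (LFm.holds_update_world _ fun ho => hΔ ⟨φ, hφ, ho⟩).1 hh⟩
  | exR Γ Δ x A t _ h₁ =>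
    intro ρ ν h
    obtain ⟨φ, hφ, hh⟩ := h₁ ρ ν h
    rcases Multiset.mem_cons.1 hφ with rfl | hφ
    · have := h (LFm.mem x (STerm.neg t)) (Multiset.mem_cons_self _ _)
      exact ⟨_, Multiset.mem_cons_self _ _, this.1, _, this.2, hh⟩
    · exact ⟨φ, hφ, hh⟩
  | decPos Γ Δ x t s _ h₁ =>
    intro ρ ν h
    have h₁ := h₁ ρ ν
    simp only [Multiset.mem_cons, forall_eq_or_imp, LFm.Holds, termVal_add,
      Set.mem_inter_iff] at h h₁ ⊢
    tauto
  | decNeg Γ Δ x t s _ _ h₁ h₂ =>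
    intro ρ ν h
    have h₁ := h₁ ρ ν
    have h₂ := h₂ ρ ν
    simp only [Multiset.mem_cons, forall_eq_or_imp, LFm.Holds, termVal_add,
      Set.mem_inter_iff] at h h₁ h₂ ⊢
    tauto
  | tauEmpty Γ Δ x =>
    intro ρ ν h
    have := (h _ (Multiset.mem_cons_self _ _)).2
    rw [termVal_single] at this
    exact absurd (Set.mem_univ _) this

/-! ## Simulation in the labelled calculus -/

theorem finite_nbhdIn (Γ : Multiset LFm) : {a | NbhdIn a Γ}.Finite := by
  classical
  have hT : ∀ t : Term, {a | NLabel.var a ∈ t.1}.Finite := fun t =>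
    Set.Finite.subset (t.1.toFinset.finite_toSet.preimage
      (f := NLabel.var) fun _ _ _ _ h => NLabel.var.inj h) fun a ha => by
        simpa using ha
  have hφ : ∀ φ : LFm, {a | φ.NbhdOccurs a}.Finite := by
    rintro (⟨y, A⟩ | ⟨t, A⟩ | ⟨t, A⟩ | ⟨y, t | t⟩ | ⟨t, y⟩)
    · exact Set.finite_empty
    all_goals exact hT t
  refine (Γ.toFinset.finite_toSet.biUnion fun φ _ => hφ φ).subset ?_
  rintro a ⟨φ, h, ha⟩
  exact Set.mem_biUnion (by simpa using h) ha

theorem finite_worldIn (Γ : Multiset LFm) : {x | WorldIn x Γ}.Finite := by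
  classical
  have hφ : ∀ φ : LFm, {x | φ.WorldOccurs x}.Finite := by
    rintro (⟨y, A⟩ | ⟨t, A⟩ | ⟨t, A⟩ | ⟨y, t | t⟩ | ⟨t, y⟩)
    all_goals first
      | exact Set.finite_empty
      | exact (Set.finite_singleton y).subset fun x (hx : y = x) => hx.symm
  refine (Γ.toFinset.finite_toSet.biUnion fun φ _ => hφ φ).subset ?_
  rintro a ⟨φ, h, ha⟩
  exact Set.mem_biUnion (by simpa using h) ha

theorem exists_fresh_nbhd (Γ Δ : Multiset LFm) : ∃ a, ¬ NbhdIn a Γ ∧ ¬ NbhdIn a Δ := by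
  obtain ⟨a, ha⟩ := ((finite_nbhdIn Γ).union (finite_nbhdIn Δ)).exists_notMem
  exact ⟨a, fun h => ha (.inl h), fun h => ha (.inr h)⟩

theorem exists_fresh_world (Γ Δ : Multiset LFm) : ∃ x, ¬ WorldIn x Γ ∧ ¬ WorldIn x Δ := by
  obtain ⟨a, ha⟩ := ((finite_worldIn Γ).union (finite_worldIn Δ)).exists_notMem
  exact ⟨a, fun h => ha (.inl h), fun h => ha (.inr h)⟩

theorem NEMultiset.induction {α : Type} {P : NEMultiset α → Prop} (single : ∀ a, P (single a))
    (add : ∀ a t, P t → P ((NEMultiset.single a).add t)) (t : NEMultiset α) : P t := by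
  obtain ⟨s, hs⟩ := t
  induction s using Multiset.induction_on with
  | empty => exact absurd rfl hs
  | cons a s ih =>
    by_cases h : s = 0
    · subst h
      exact single a
    · exact add a ⟨s, h⟩ (ih h)

/-- Repeated `dec` splits off one label at a time. The goal is passed on as a continuation over all
larger antecedents, since the rules only add formulas. -/
theorem LProvable.decPos_labels {L : CubeSystem} {x : WLabel} {Δ : Multiset LFm} (t : Term) :
    ∀ Γ : Multiset LFm, LFm.mem x (STerm.pos t) ∈ Γ →
      (∀ Γ', Γ ≤ Γ' → (∀ a ∈ t.1, LFm.mem x (STerm.pos (NEMultiset.single a)) ∈ Γ') →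
        LProvable L ⟨Γ', Δ⟩) → LProvable L ⟨Γ, Δ⟩ := by
  induction t using NEMultiset.induction with
  | single a => exact fun Γ hΓ h => h Γ le_rfl (by simpa using hΓ)
  | add a t ih =>
    intro Γ hΓ h
    obtain ⟨Γ, rfl⟩ := Multiset.exists_cons_of_mem hΓ
    refine LProvable.decPos _ _ _ _ _ (ih _ (by simp) fun Γ' hle hΓ' => h Γ' ?_ ?_)
    · exact ((Multiset.le_cons_self _ _).trans (Multiset.le_cons_self _ _)).trans hle
    · intro b hb
      rcases Multiset.mem_add.1 hb with hb | hb
      · obtain rfl := Multiset.mem_singleton.1 hb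
        exact Multiset.subset_of_le hle (by simp)
      · exact hΓ' b hb

/-- The dual of `LProvable.decPos_labels`: each application branches, leaving one continuation for
each label of the term. -/
theorem LProvable.decNeg_labels {L : CubeSystem} {x : WLabel} {Δ : Multiset LFm} (t : Term) :
    ∀ Γ : Multiset LFm, LFm.mem x (STerm.neg t) ∈ Γ →
      (∀ a ∈ t.1, ∀ Γ', Γ ≤ Γ' → LFm.mem x (STerm.neg (NEMultiset.single a)) ∈ Γ' →
        LProvable L ⟨Γ', Δ⟩) → LProvable L ⟨Γ, Δ⟩ := by
  induction t using NEMultiset.induction with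
  | single a => exact fun Γ hΓ h => h a (by simp) Γ le_rfl hΓ
  | add a t ih =>
    intro Γ hΓ h
    obtain ⟨Γ, rfl⟩ := Multiset.exists_cons_of_mem hΓ
    refine LProvable.decNeg _ _ _ _ _ (h a (by simp) _ (Multiset.le_cons_self _ _) (by simp))
      (ih _ (by simp) fun b hb Γ' hle hΓ' =>
        h b (by simp [hb]) Γ' ((Multiset.le_cons_self _ _).trans hle) hΓ')

theorem LProvable.allL_of_mem {L : CubeSystem} {Γ Δ : Multiset LFm} {x : WLabel} {A : Fm} {t : Term}
    (h₁ : LFm.mem x (STerm.pos t) ∈ Γ) (h₂ : LFm.all t A ∈ Γ)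
    (h : LProvable L ⟨LFm.holds x A ::ₘ Γ, Δ⟩) : LProvable L ⟨Γ, Δ⟩ := by
  obtain ⟨Γ, rfl⟩ := Multiset.exists_cons_of_mem h₁
  obtain ⟨Γ, rfl⟩ := Multiset.exists_cons_of_mem (by simpa using h₂ : LFm.all t A ∈ Γ)
  refine LProvable.allL _ _ _ _ _ ?_
  rwa [Multiset.cons_swap]

theorem LProvable.allL_labels {L : CubeSystem} {Δ : Multiset LFm} {x : WLabel}
    (Q : Multiset (NLabel × Fm)) : ∀ Γ : Multiset LFm,
      (∀ q ∈ Q, LFm.mem x (STerm.pos (NEMultiset.single q.1)) ∈ Γ ∧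
        LFm.all (NEMultiset.single q.1) q.2 ∈ Γ) →
      LProvable L ⟨Q.map (fun q => LFm.holds x q.2) + Γ, Δ⟩ → LProvable L ⟨Γ, Δ⟩ := by
  induction Q using Multiset.induction_on with
  | empty => intro Γ _ h; simpa using h
  | cons q Q ih =>
    intro Γ hΓ h
    obtain ⟨h₁, h₂⟩ := hΓ q (by simp)
    refine LProvable.allL_of_mem h₁ h₂ (ih _ (fun r hr => ?_) ?_)
    · have := hΓ r (by simp [hr])
      exact ⟨by simp [this.1], by simp [this.2]⟩
    · simpa using h

theorem LProvable.exR_of_mem {L : CubeSystem} {Γ Δ : Multiset LFm} {x : WLabel} {A : Fm} {t : Term}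
    (h₁ : LFm.mem x (STerm.neg t) ∈ Γ) (h₂ : LFm.ex t A ∈ Δ)
    (h : LProvable L ⟨Γ, LFm.holds x A ::ₘ Δ⟩) : LProvable L ⟨Γ, Δ⟩ := by
  obtain ⟨Γ, rfl⟩ := Multiset.exists_cons_of_mem h₁
  obtain ⟨Δ, rfl⟩ := Multiset.exists_cons_of_mem h₂
  exact LProvable.exR _ _ _ _ _ h

/-- The labelled sequent `Γ ⇒ Δ` determines the meaning of the labels of the block `S`. -/
def LBlock.Supported (Γ Δ : Multiset LFm) (S : LBlock) : Prop :=
  -- The exception accounts for the block created by rule N, which comes without forcing formulas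
  -- for `τ`.
  ∀ q ∈ S.1, q = (NLabel.tau, Fm.top) ∨
    (LFm.all (NEMultiset.single q.1) q.2 ∈ Γ ∧ LFm.ex (NEMultiset.single q.1) q.2 ∈ Δ)

theorem LBlock.Supported.mono {Γ Γ' Δ Δ' : Multiset LFm} {S : LBlock} (h : S.Supported Γ Δ)
    (hΓ : Γ ≤ Γ') (hΔ : Δ ≤ Δ') : S.Supported Γ' Δ' := fun q hq =>
  (h q hq).imp_right fun h' => ⟨Multiset.subset_of_le hΓ h'.1, Multiset.subset_of_le hΔ h'.2⟩

@[simp] theorem LBlock.supported_holds_left {Γ Δ : Multiset LFm} {S : LBlock} {x : WLabel} {A : Fm} :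
    S.Supported (LFm.holds x A ::ₘ Γ) Δ ↔ S.Supported Γ Δ := by simp [LBlock.Supported]

@[simp] theorem LBlock.supported_holds_right {Γ Δ : Multiset LFm} {S : LBlock} {x : WLabel}
    {A : Fm} : S.Supported Γ (LFm.holds x A ::ₘ Δ) ↔ S.Supported Γ Δ := by
  simp [LBlock.Supported]

@[simp] theorem LBlock.supported_nbhd_left {Γ Δ : Multiset LFm} {S : LBlock} {t : Term}
    {x : WLabel} : S.Supported (LFm.nbhd t x ::ₘ Γ) Δ ↔ S.Supported Γ Δ := by
  simp [LBlock.Supported]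

open Classical in
/-- A labelled sequent is provable if it extends the translation of a provable sequent. -/
theorem SProvable.lProvable {L : CubeSystem} {c : Sequent} (h : SProvable L c) :
    ∀ (x : WLabel) (𝓑 : Multiset LBlock) (Γ Δ : Multiset LFm), 𝓑.map LBlock.toBlock = c.blocks →
      c.ant.map (LFm.holds x) + 𝓑.map (fun S => LFm.nbhd S.term x) ≤ Γ →
      c.suc.map (LFm.holds x) ≤ Δ → (∀ S ∈ 𝓑, S.Supported Γ Δ) → LProvable L ⟨Γ, Δ⟩ := by
  induction h with
  | ax Γ Θ Δ p =>
    intro x 𝓑 Γ' Δ' h𝓑 hΓ hΔ hS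
    simp only [Multiset.map_cons, Multiset.cons_add] at hΓ hΔ
    obtain ⟨Γ', rfl, -⟩ := Multiset.exists_cons_of_cons_le hΓ
    obtain ⟨Δ', rfl, -⟩ := Multiset.exists_cons_of_cons_le hΔ
    exact LProvable.ax _ _ _ _
  | botL Γ Θ Δ =>
    intro x 𝓑 Γ' Δ' h𝓑 hΓ hΔ hS
    simp only [Multiset.map_cons, Multiset.cons_add] at hΓ
    obtain ⟨Γ', rfl, -⟩ := Multiset.exists_cons_of_cons_le hΓ
    exact LProvable.botL _ _ _
  | topR Γ Θ Δ =>
    intro x 𝓑 Γ' Δ' h𝓑 hΓ hΔ hS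
    simp only [Multiset.map_cons] at hΔ
    obtain ⟨Δ', rfl, -⟩ := Multiset.exists_cons_of_cons_le hΔ
    exact LProvable.topR _ _ _
  | impL Γ Θ Δ A B _ _ h₁ h₂ =>
    intro x 𝓑 Γ' Δ' h𝓑 hΓ hΔ hS
    simp only [Multiset.map_cons, Multiset.cons_add] at hΓ hΔ
    obtain ⟨Γ', rfl, hΓ₁⟩ := Multiset.exists_cons_of_cons_le hΓ
    simp only [LBlock.supported_holds_left] at hS
    refine LProvable.impL _ _ _ _ _ (h₁ x 𝓑 _ _ h𝓑 hΓ₁ ?_ ?_) (h₂ x 𝓑 _ _ h𝓑 ?_ hΔ ?_)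
    all_goals simpa
  | impR Γ Θ Δ A B _ h₁ =>
    intro x 𝓑 Γ' Δ' h𝓑 hΓ hΔ hS
    simp only [Multiset.map_cons] at hΓ hΔ
    obtain ⟨Δ', rfl, hΔ₁⟩ := Multiset.exists_cons_of_cons_le hΔ
    simp only [LBlock.supported_holds_right] at hS
    refine LProvable.impR _ _ _ _ _ (h₁ x 𝓑 _ _ h𝓑 ?_ ?_ ?_)
    all_goals simpa
  | andL Γ Θ Δ A B _ h₁ =>
    intro x 𝓑 Γ' Δ' h𝓑 hΓ hΔ hS
    simp only [Multiset.map_cons, Multiset.cons_add] at hΓ hΔ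
    obtain ⟨Γ', rfl, hΓ₁⟩ := Multiset.exists_cons_of_cons_le hΓ
    simp only [LBlock.supported_holds_left] at hS
    refine LProvable.andL _ _ _ _ _ (h₁ x 𝓑 _ _ h𝓑 ?_ hΔ ?_)
    all_goals simpa
  | andR Γ Θ Δ A B _ _ h₁ h₂ =>
    intro x 𝓑 Γ' Δ' h𝓑 hΓ hΔ hS
    simp only [Multiset.map_cons] at hΓ hΔ
    obtain ⟨Δ', rfl, hΔ₁⟩ := Multiset.exists_cons_of_cons_le hΔ
    simp only [LBlock.supported_holds_right] at hS
    refine LProvable.andR _ _ _ _ _ (h₁ x 𝓑 _ _ h𝓑 hΓ ?_ ?_) (h₂ x 𝓑 _ _ h𝓑 hΓ ?_ ?_)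
    all_goals simpa
  | orL Γ Θ Δ A B _ _ h₁ h₂ =>
    intro x 𝓑 Γ' Δ' h𝓑 hΓ hΔ hS
    simp only [Multiset.map_cons, Multiset.cons_add] at hΓ hΔ
    obtain ⟨Γ', rfl, hΓ₁⟩ := Multiset.exists_cons_of_cons_le hΓ
    simp only [LBlock.supported_holds_left] at hS
    refine LProvable.orL _ _ _ _ _ (h₁ x 𝓑 _ _ h𝓑 ?_ hΔ ?_) (h₂ x 𝓑 _ _ h𝓑 ?_ hΔ ?_)
    all_goals simpa
  | orR Γ Θ Δ A B _ h₁ =>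
    intro x 𝓑 Γ' Δ' h𝓑 hΓ hΔ hS
    simp only [Multiset.map_cons] at hΓ hΔ
    obtain ⟨Δ', rfl, hΔ₁⟩ := Multiset.exists_cons_of_cons_le hΔ
    simp only [LBlock.supported_holds_right] at hS
    refine LProvable.orR _ _ _ _ _ (h₁ x 𝓑 _ _ h𝓑 hΓ ?_ ?_)
    all_goals simpa
  | boxL Γ Θ Δ A _ h₁ =>
    intro x 𝓑 Γ' Δ' h𝓑 hΓ hΔ hS
    simp only [Multiset.map_cons, Multiset.cons_add] at hΓ hΔ
    obtain ⟨Γ', rfl, hΓ₁⟩ := Multiset.exists_cons_of_cons_le hΓ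
    simp only [LBlock.supported_holds_left] at hS
    -- The left box rule adds, along with `a ▷ x`, exactly the two forcing formulas that support the
    -- new block.
    obtain ⟨a, ha, ha'⟩ := exists_fresh_nbhd Γ' Δ'
    refine LProvable.boxL _ _ _ _ a ha ha'
      (h₁ x (NEMultiset.single (NLabel.var a, A) ::ₘ 𝓑) _ _ ?_ ?_ ?_ ?_)
    · rw [Multiset.map_cons, h𝓑]; rfl
    · rw [Multiset.map_cons, Multiset.add_cons]
      exact Multiset.cons_le_cons _ (hΓ₁.trans (Multiset.le_cons_self _ _))
    · exact le_trans hΔ (Multiset.le_cons_self _ _)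
    · intro S hS'
      rcases Multiset.mem_cons.1 hS' with rfl | hS'
      · simp [LBlock.Supported]
      · rw [LBlock.supported_nbhd_left]
        exact (hS S hS').mono (Multiset.le_cons_self _ _)
          (Multiset.le_cons_self _ _)
  | boxR Γ Θ Δ S B _ _ h₁ h₂ =>
    intro x 𝓑 Γ' Δ' h𝓑 hΓ hΔ hS
    obtain ⟨S, 𝓑, rfl, rfl, -⟩ := Multiset.exists_of_map_eq_cons h𝓑
    have hS𝓑 := Multiset.mem_cons_self S 𝓑
    have hnb : LFm.nbhd S.term x ∈ Γ' := Multiset.subset_of_le hΓ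
      (Multiset.mem_add.2 (.inr (Multiset.mem_map_of_mem _ hS𝓑)))
    have hsup := hS S hS𝓑
    obtain ⟨Γ', rfl⟩ := Multiset.exists_cons_of_mem hnb
    simp only [Multiset.map_cons] at hΔ
    obtain ⟨Δ', rfl, -⟩ := Multiset.exists_cons_of_cons_le hΔ
    -- The first premiss takes a generic world in `t` and imports the formulas of the block; the
    -- second takes a generic world in `t̄` satisfying `B` and treats each label separately.
    refine LProvable.boxR _ _ _ _ _ ?_ ?_
    · obtain ⟨y, hy, hy'⟩ := exists_fresh_world (LFm.nbhd S.term x ::ₘ Γ')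
        (LFm.holds x B.box ::ₘ Δ')
      refine LProvable.allR _ _ y _ _ hy hy'
        (LProvable.decPos_labels (x := y) S.term _ (by simp) ?_)
      intro Γ'' hle hΓ''
      refine LProvable.allL_labels (x := y) (S.1.filter fun q => q.2 ≠ Fm.top) Γ'' (fun q hq => ?_) ?_
      · obtain ⟨hq, hqt⟩ := Multiset.mem_filter.1 hq
        refine ⟨hΓ'' q.1 (Multiset.mem_map_of_mem _ hq), ?_⟩
        rcases hsup q hq with rfl | hq
        · exact absurd rfl hqt
        · exact Multiset.subset_of_le hle (Multiset.mem_cons_of_mem hq.1)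
      · refine h₁ y 0 _ _ (by simp) ?_ (by simp) (by simp)
        simp [LBlock.toBlock, NEMultiset.map, Multiset.filter_map]
    · obtain ⟨y, hy, hy'⟩ := exists_fresh_world (LFm.nbhd S.term x ::ₘ Γ')
        (LFm.holds x B.box ::ₘ Δ')
      rw [Multiset.cons_swap]
      refine LProvable.exL _ _ y _ _ hy hy' ?_
      by_cases hM : L.hasM = true
      · have : LFm.mem y (STerm.neg S.term) ::ₘ LFm.holds y B ::ₘ LFm.nbhd S.term x ::ₘ Γ' =
            LFm.nbhd S.term x ::ₘ LFm.mem y (STerm.neg S.term) ::ₘ LFm.holds y B ::ₘ Γ' := by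
          rw [Multiset.cons_swap (LFm.holds y B), Multiset.cons_swap]
        rw [this]
        exact LProvable.ruleM hM _ _ _ _ _
      · rw [Bool.not_eq_true] at hM
        refine LProvable.decNeg_labels (x := y) S.term _ (by simp) fun a ha Γ'' hle hΓ'' => ?_
        obtain ⟨q, hq, rfl⟩ := Multiset.mem_map.1 ha
        -- An unsupported label is `τ`, whose complement is empty. A supported one brings its
        -- formula into the succedent, where `⊤` closes the branch at once.
        rcases hsup q hq with rfl | hq'
        · obtain ⟨Γ'', rfl⟩ := Multiset.exists_cons_of_mem hΓ''
          exact LProvable.tauEmpty _ _ _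
        · refine LProvable.exR_of_mem hΓ'' hq'.2 ?_
          by_cases hqt : q.2 = Fm.top
          · rw [hqt]
            exact LProvable.topR _ _ _
          · refine h₂ hM q.2 (Multiset.mem_map_of_mem _ hq) hqt y 0 _ _ (by simp) ?_ (by simp)
              (by simp)
            simpa using Multiset.subset_of_le hle
              (Multiset.mem_cons_of_mem (Multiset.mem_cons_self _ _))
  | ruleN hN Γ Θ Δ B _ h₁ =>
    intro x 𝓑 Γ' Δ' h𝓑 hΓ hΔ hS
    refine LProvable.ruleN hN _ _ x (.inr ⟨LFm.holds x B.box, ?_, rfl⟩)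
      (h₁ x (NEMultiset.single (NLabel.tau, Fm.top) ::ₘ 𝓑) _ _ ?_ ?_ hΔ ?_)
    · exact Multiset.subset_of_le hΔ (by simp)
    · rw [Multiset.map_cons, h𝓑]; rfl
    · rw [Multiset.map_cons, Multiset.add_cons]
      exact Multiset.cons_le_cons _ hΓ
    · intro S hS'
      rcases Multiset.mem_cons.1 hS' with rfl | hS'
      · simp [LBlock.Supported]
      · rw [LBlock.supported_nbhd_left]
        exact hS S hS'
  | ruleC hC Γ Θ Δ S P _ h₁ =>
    intro x 𝓑 Γ' Δ' h𝓑 hΓ hΔ hS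
    obtain ⟨S, 𝓑, rfl, rfl, h𝓑₁⟩ := Multiset.exists_of_map_eq_cons h𝓑
    obtain ⟨P, 𝓑, rfl, rfl, h𝓑₂⟩ := Multiset.exists_of_map_eq_cons h𝓑₁
    simp only [Multiset.map_cons, Multiset.add_cons] at hΓ
    obtain ⟨Γ', rfl, hΓ₁⟩ := Multiset.exists_cons_of_cons_le hΓ
    obtain ⟨Γ', rfl, hΓ₂⟩ := Multiset.exists_cons_of_cons_le hΓ₁
    have hterm : LBlock.term (S.add P) = S.term.add P.term := Subtype.ext (Multiset.map_add _ _ _)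
    have hblock : LBlock.toBlock (S.add P) = S.toBlock.add P.toBlock :=
      Subtype.ext (Multiset.map_add _ _ _)
    refine LProvable.ruleC hC _ _ _ _ _ (h₁ x (S.add P ::ₘ 𝓑) _ _ ?_ ?_ hΔ ?_)
    · rw [Multiset.map_cons, h𝓑₂, hblock]
    · rw [Multiset.map_cons, Multiset.add_cons, hterm]
      exact Multiset.cons_le_cons _
        (hΓ₂.trans ((Multiset.le_cons_self _ _).trans (Multiset.le_cons_self _ _)))
    · simp only [LBlock.supported_nbhd_left] at hS ⊢
      intro Q hQ
      rcases Multiset.mem_cons.1 hQ with rfl | hQ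
      · intro q hq
        rcases Multiset.mem_add.1 hq with hq | hq
        · exact hS S (by simp) q hq
        · exact hS P (by simp) q hq
      · exact hS Q (by simp [hQ])

/-! ## The equivalence -/

namespace Labelling

variable {n : ℕ} (D : Labelling n)

theorem compAnt_le (k : Fin n) : D.compAnt k ≤ D.translation.ant :=
  Finset.single_le_sum (f := D.compAnt) (fun _ _ => Multiset.zero_le _) (Finset.mem_univ k)

theorem compSuc_le (k : Fin n) : D.compSuc k ≤ D.translation.suc :=
  Finset.single_le_sum (f := D.compSuc) (fun _ _ => Multiset.zero_le _) (Finset.mem_univ k)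

/-- The translation contains that of the `k`-th component with its forcing formulas; everything
else, origins included, is weakening. -/
theorem lProvable_of_valid {L : CubeSystem} (k : Fin n) (h : (D.comp k).toSequent.Valid L) :
    LProvable L D.translation := by
  refine (SProvable.of_valid h).lProvable (D.world k) (D.comp k).blocks _ _ rfl ?_ ?_ ?_
  · refine le_trans ?_ (D.compAnt_le k)
    rw [add_comm, compAnt]
    refine add_le_add ?_ le_rfl
    refine le_trans ?_ (Multiset.le_add_right _ _)
    exact Multiset.le_add_left _ _
  · exact le_trans (Multiset.le_add_right _ _) (D.compSuc_le k)
  · intro S hS q hq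
    refine .inr ⟨Multiset.subset_of_le (D.compAnt_le k) ?_,
      Multiset.subset_of_le (D.compSuc_le k) ?_⟩
    · simp only [compAnt, Multiset.mem_add, Multiset.mem_bind, Multiset.mem_map]
      exact .inl (.inr ⟨S, hS, q, hq, rfl⟩)
    · simp only [compSuc, Multiset.mem_add, Multiset.mem_bind, Multiset.mem_map]
      exact .inr ⟨S, hS, q, hq, rfl⟩

/-- The interpretation of neighbourhood labels by the formulas to which they are attached. -/
def labelVal {L : CubeSystem} (M : NModel L) (a : ℕ) : Set M.W :=
  {v | ∃ k A, D.Attaches k (NLabel.var a) A ∧ v ∈ M.truth A}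

variable {D}

/-- By consistency the union defining `labelVal` ranges over a single formula, and `τ`, read as the
whole space, agrees with `⊤`. -/
theorem val_labelVal (hc : D.Consistent) {L : CubeSystem} (M : NModel L) {k : Fin n} {a : NLabel}
    {A : Fm} (h : D.Attaches k a A) : a.val (D.labelVal M) = M.truth A := by
  cases a with
  | tau =>
    rw [hc.2 k A h]; rfl
  | var a =>
    ext v
    refine ⟨?_, fun hv => ⟨k, A, h, hv⟩⟩
    rintro ⟨k', A', h', hv⟩
    rwa [hc.1 k k' _ _ _ h h']

theorem termVal_labelVal (hc : D.Consistent) {L : CubeSystem} (M : NModel L) {k : Fin n}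
    {S : LBlock} (hS : S ∈ (D.comp k).blocks) :
    termVal (D.labelVal M) S.term = M.truthAll S.toBlock.1 := by
  ext v
  constructor
  · intro h A hA
    obtain ⟨q, hq, rfl⟩ := Multiset.mem_map.1 hA
    rw [← val_labelVal hc M ⟨S, hS, hq⟩]
    exact h q.1 (Multiset.mem_map_of_mem _ hq)
  · intro h a ha
    obtain ⟨q, hq, rfl⟩ := Multiset.mem_map.1 ha
    rw [val_labelVal hc M ⟨S, hS, hq⟩]
    exact h q.2 (Multiset.mem_map_of_mem _ hq)

theorem exists_valid_of_lProvable {L : CubeSystem} (hx : Function.Injective D.world)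
    (hc : D.Consistent) (hb : D.OriginsAdmissible L) (h : LProvable L D.translation) :
    ∃ k, (D.comp k).toSequent.Valid L := by
  obtain ⟨U, ⟨w₀⟩, hU⟩ := NModel.exists_universal L
  by_contra hn
  push Not at hn
  choose w hw using fun k => hU _ (hn k)
  -- Injectivity of the labels makes this well behaved: each `x_k` goes to a world falsifying its
  -- component, all other labels to the default world.
  let ρ : WLabel → U.W := Function.extend D.world w fun _ => w₀
  have hρ : ∀ k, ρ (D.world k) = w k := hx.extend_apply w _
  obtain ⟨φ, hφ, hh⟩ := h.sound U ρ (D.labelVal U) (by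
    intro φ hφ
    obtain ⟨m, -, hφ⟩ := Multiset.mem_sum.1 (show φ ∈ ∑ k, D.compAnt k from hφ)
    simp only [compAnt, Multiset.mem_add, Multiset.mem_bind, Multiset.mem_map] at hφ
    rcases hφ with ((hφ | ⟨S, hS, rfl⟩) | ⟨S, hS, q, hq, rfl⟩) | ⟨A, hA, rfl⟩
    · cases ho : D.origin m with
      | none => simp [ho] at hφ
      | some u =>
        simp only [ho, Multiset.mem_singleton] at hφ
        subst hφ
        -- An admissible origin is true under this interpretation: the falsifying world makes the
        -- antecedent of component `m` true, hence lies in the block, or makes a block formula in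
        -- its succedent false, hence lies outside.
        obtain ⟨k, -, S, hS, ⟨rfl, hA⟩ | ⟨rfl, hM, A, hA, hA'⟩⟩ := hb m u ho
        · change ρ _ ∈ _
          rw [termVal_labelVal hc U hS, hρ]
          exact fun A hAS => (hw m).1 A (hA A hAS)
        · refine ⟨hM, ?_⟩
          rw [termVal_labelVal hc U hS, hρ]
          exact fun hv => (hw m).2.2 A hA' (hv A hA)
    · change _ ∈ U.N (ρ _)
      rw [termVal_labelVal hc U hS, hρ]
      exact (hw m).2.1 _ (Multiset.mem_map_of_mem _ hS)
    · change termVal _ _ ⊆ _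
      rw [termVal_single, val_labelVal hc U ⟨S, hS, hq⟩]
    · change ρ _ ∈ _
      rw [hρ]
      exact (hw m).1 A hA)
  obtain ⟨m, -, hφ⟩ := Multiset.mem_sum.1 (show φ ∈ ∑ k, D.compSuc k from hφ)
  simp only [compSuc, Multiset.mem_add, Multiset.mem_bind, Multiset.mem_map] at hφ
  rcases hφ with ⟨A, hA, rfl⟩ | ⟨S, hS, q, hq, rfl⟩
  · change ρ _ ∈ _ at hh
    rw [hρ] at hh
    exact (hw m).2.2 A hA hh
  · obtain ⟨-, v, hv, hv'⟩ := hh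
    rw [termVal_single, val_labelVal hc U ⟨S, hS, hq⟩] at hv
    exact hv hv'

end Labelling

theorem mainTheorem5 (L : CubeSystem) (n : ℕ) (H : Hypersequent) (D : Labelling n)
    (hH : D.Enumerates H) (hx : Function.Injective D.world) (hc : D.Consistent)
    (hb : D.OriginsAdmissible L) :
    HProvable L H ↔ LProvable L D.translation := by
  have hval : HProvable L H ↔ ∃ k, (D.comp k).toSequent.Valid L := by
    rw [hProvable_iff_exists_valid, ← hH]
    simp
  rw [hval]
  exact ⟨fun ⟨k, hk⟩ => D.lProvable_of_valid k hk,
    Labelling.exists_valid_of_lProvable hx hc hb⟩
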